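/- Let $R$ be a commutative Noetherian ring with identity, $I$ an ideal of $R$, $M$ a finitely generated $R$-module, and $h\in\mathbb{Z}$. Write $H^i_I(M)$ for the $i$-th local cohomology module of $M$ with support in $I$ (with $H^i_I(M)=0$ for $i<0$). An $R$-module $N$ is called $I$-cofinite if $\operatorname{Supp}_R N\subseteq V(I)$, where $V(I)$ is the set of prime ideals containing $I$, and $\operatorname{Ext}^i_R(R/I,N)$ is finitely generated for all $i\ge 0$. (a) If $R$ is local and $\dim R\le 2$, then $H^i_I(M)$ is $I$-cofinite for all $i\ge 0$. (b) If $H^i_I(M)$ is finitely generated for all $i<h$ and $H^i_I(M)=0$ for all $i>h$, then $H^i_I(M)$ is $I$-cofinite for all $i$. In particular, if $H^i_I(M)=0$ for all $i>1$, then $H^i_I(M)$ is $I$-cofinite for all $i$. (c) If $H^i_I(M)=0$ for all $i\ne h,h+1$, then $H^h_I(M)$ is $I$-cofinite if and only if $H^{h+1}_I(M)$ is $I$-cofinite. -/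

import Mathlib

open CategoryTheory

universe u

namespace LocalCohomologyCofinite

/-- The local cohomology module `H^i_I(M)` of an `R`-module `M` with support in the ideal `I`,
indexed by all integers `i`: for `i ≥ 0` it is the direct limit over `t` of `Ext^i_R(R/I^t, M)`
(Mathlib's `localCohomology`), and for `i < 0` it is the zero module. -/
noncomputable def H {R : Type u} [CommRing R] (I : Ideal R) (M : Type u) [AddCommGroup M]
    [Module R M] : ℤ → ModuleCat.{u} R
  | Int.ofNat n => (localCohomology I n).obj (ModuleCat.of R M)
  | Int.negSucc _ => ModuleCat.of R PUnit.{u + 1}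

/-- An `R`-module `N` is `I`-cofinite if `Supp_R N ⊆ V(I)` and `Ext^i_R(R/I, N)` is a finitely
generated `R`-module for all `i ≥ 0`. -/
structure IsCofinite {R : Type u} [CommRing R] (I : Ideal R) (N : ModuleCat.{u} R) : Prop where
  support_subset : Module.support R N ⊆ PrimeSpectrum.zeroLocus (I : Set R)
  finite_ext : ∀ i : ℕ, Module.Finite R (Abelian.Ext (ModuleCat.of R (R ⧸ I)) N i)

end LocalCohomologyCofinite

/-!
Local cohomology `H^n_I(N)` is the direct limit of the modules `Ext^n(R / I ^ t, N)`. Mathlib's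
`localCohomology` uses the `Ext` defined by left derived functors; `localCohomologyEquiv` identifies
it with the direct limit `ExtLimit` formed with the derived-category `Ext`, for which long exact
sequences are available. Local cohomology modules are `I`-torsion, so their supports lie in `V(I)`
and cofiniteness only concerns the finiteness of `Ext^i(R / I, -)`, named `HasFiniteExt` below.

Parts (b) and (c) follow from one principle, `HasFiniteExt.extLimit`: if `N` and all but one of its
local cohomology modules have finitely generated `Ext`s from `R / I`, and almost all of these
modules vanish, then the remaining one has them as well. This is a usual consequence of the spectral
sequence `Ext^p(R / I, H^q_I(N)) ⇒ Ext^(p+q)(R / I, N)`, obtained here by degree shifting. Over a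
Noetherian ring `Γ_I` preserves injective modules (`injective_idealTorsion`). Therefore `N / Γ_I(N)`
embeds into an injective module without `I`-torsion, and the cokernel `N₁` of this embedding has the
local cohomology of `N` with degrees lowered by one. The modules `Γ_I(N)`, `N` and `N₁` satisfy a
two-out-of-three property for `HasFiniteExt` (`exists_shift`).

In part (a), `H⁰` is finitely generated, `H^n` vanishes for `n > 2`, and by the same principle it is
enough to treat `H²`. Replace `M` by `M / Γ_I(M)` and take `x ∈ I` regular on `M`. Then `H²(M)` is
`x`-divisible, so it is enough to treat `Q = 0 :_{H²(M)} x` (`HasFiniteExt.of_smulKer`). The module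
`Q` is a quotient of `H¹(M / xM)`. As `dim M / xM ≤ 1`, there is `y ∈ I` for which `H¹(M / xM)` is
`y`-divisible and `0 :_{H¹(M / xM)} y` has finite length. The key point is that the same holds for
the quotient `Q` (`finite_smulKer_of_surjective`, by a comparison of lengths), and
`HasFiniteExt.of_smulKer` applies once more.
-/

open Abelian Limits Opposite
open scoped Pointwise

noncomputable section

variable {R : Type u} [CommRing R]

/-! ### Naturality of the computation of `Ext` by projective resolutions -/

section
variable {X X' : ModuleCat.{u} R} (P : ProjectiveResolution X) (P' : ProjectiveResolution X')

/-- The cochain map `Hom(L, Y) ⟶ Hom(K, Y)` induced by a chain map `φ : K ⟶ L`. -/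
def linearYonedaObjMap {K L : ChainComplex (ModuleCat.{u} R) ℕ} (φ : K ⟶ L) (Y : ModuleCat.{u} R) :
    L.linearYonedaObj R Y ⟶ K.linearYonedaObj R Y :=
  (HomologicalComplex.unopFunctor _ _).map
    (((((linearYoneda R (ModuleCat.{u} R)).obj Y).rightOp.mapHomologicalComplex _).map φ).op)

/-- The computation of the derived-functor `Ext` by a projective resolution is natural in the first
variable. -/
lemma isoExt_naturality (g : X ⟶ X') (φ : ProjectiveResolution.Hom P P' g) (n : ℕ)
    (Y : ModuleCat.{u} R) :
  ((Ext R (ModuleCat.{u} R) n).map g.op).app Y ≫ (P.isoExt n Y).hom =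
   (P'.isoExt n Y).hom ≫ HomologicalComplex.homologyMap (linearYonedaObjMap φ.hom Y) n := by
  -- Both sides are unopped versions of the corresponding statement for the left derived functor
  -- of `Hom(-, Y)ᵒᵖ`, up to the identification of the homology of an opposite complex.
  have h1 := ProjectiveResolution.isoLeftDerivedObj_inv_naturality g P P' φ.hom
      φ.hom_f_zero_comp_π_f_zero ((linearYoneda R (ModuleCat.{u} R)).obj Y).rightOp n
  have h2 := HomologicalComplex.homologyOp_hom_naturality (linearYonedaObjMap φ.hom Y) n
  have h1' := congrArg Quiver.Hom.unop h1
  have h2' := congrArg Quiver.Hom.unop h2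
  rw [← cancel_mono ((P.complex.linearYonedaObj R Y).homologyOp n).hom.unop, Category.assoc,
      Category.assoc]
  refine Eq.trans ?_ (congrArg ((P'.isoExt n Y).hom ≫ ·) h2')
  have e1 : (P.isoExt n Y).hom ≫ ((P.complex.linearYonedaObj R Y).homologyOp n).hom.unop =
    (P.isoLeftDerivedObj ((linearYoneda R (ModuleCat.{u} R)).obj Y).rightOp n).inv.unop := by
    refine (Category.assoc _ _ _).trans ?_
    refine (congrArg (_ ≫ ·) (?_ : _ = 𝟙 _)).trans (Category.comp_id _)
    exact congrArg Quiver.Hom.unop ((P.complex.linearYonedaObj R Y).homologyOp n).hom_inv_id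
  have e2 : (P'.isoExt n Y).hom ≫ ((P'.complex.linearYonedaObj R Y).homologyOp n).hom.unop =
    (P'.isoLeftDerivedObj ((linearYoneda R (ModuleCat.{u} R)).obj Y).rightOp n).inv.unop := by
    refine (Category.assoc _ _ _).trans ?_
    refine (congrArg (_ ≫ ·) (?_ : _ = 𝟙 _)).trans (Category.comp_id _)
    exact congrArg Quiver.Hom.unop ((P'.complex.linearYonedaObj R Y).homologyOp n).hom_inv_id
  refine (congrArg (((Ext R (ModuleCat.{u} R) n).map g.op).app Y ≫ ·) e1).trans ?_
  refine (h1'.trans ?_)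
  rw [unop_comp]
  refine (congrArg (· ≫ _) e2.symm).trans ?_
  rfl
end

/-! ### Comparison of the two definitions of `Ext` -/

namespace CochainHomology
variable (K : CochainComplex (ModuleCat.{u} R) ℕ) (n : ℕ)

lemma homologyπ_surjective : Function.Surjective (K.homologyπ n).hom :=
  (ModuleCat.epi_iff_surjective _).1 inferInstance

lemma exists_d_eq_of_homologyπ_eq_zero (z : K.cycles n) (hz : (K.homologyπ n).hom z = 0) :
    ∃ w, (K.d ((ComplexShape.up ℕ).prev n) n).hom w = (K.iCycles n).hom z := by
  have h := ShortComplex.exact_of_g_is_cokernel (ShortComplex.mk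
      (K.toCycles ((ComplexShape.up ℕ).prev n) n) (K.homologyπ n) (by simp))
      (K.homologyIsCokernel _ n rfl)
  obtain ⟨w, hw⟩ := (ShortComplex.moduleCat_exact_iff _).1 h z hz
  refine ⟨w, ?_⟩
  rw [← hw]
  exact (congrArg (fun f => f.hom w) (K.toCycles_i ((ComplexShape.up ℕ).prev n) n)).symm

lemma homologyπ_eq_zero (z : K.cycles n) (i : ℕ) (w : K.X i)
    (hw : (K.d i n).hom w = (K.iCycles n).hom z) :
    (K.homologyπ n).hom z = 0 := by
  have : z = (K.toCycles i n).hom w := by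
    apply (ModuleCat.mono_iff_injective (K.iCycles n)).1 inferInstance
    refine hw.symm.trans ?_
    exact (congrArg (fun f => f.hom w) (K.toCycles_i i n)).symm
  rw [this]
  exact congrArg (fun f => f.hom w) (K.toCycles_comp_homologyπ i n)

lemma exists_iCycles_eq (x : K.X n) (hx : (K.d n (n+1)).hom x = 0) :
    ∃ z, (K.iCycles n).hom z = x := by
  have h := ShortComplex.exact_of_f_is_kernel (ShortComplex.mk (K.iCycles n) (K.d n (n+1))
      (by simp)) (K.cyclesIsKernel n (n+1) (by simp))
  exact (ShortComplex.moduleCat_exact_iff _).1 h x hx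

lemma d_iCycles (z : K.cycles n) : (K.d n (n+1)).hom ((K.iCycles n).hom z) = 0 :=
  congrArg (fun f => f.hom z) (K.iCycles_d n (n+1))

end CochainHomology

namespace CategoryTheory.ProjectiveResolution
variable {X X' : ModuleCat.{u} R} (P : ProjectiveResolution X) (P' : ProjectiveResolution X')
  (Y : ModuleCat.{u} R) (n : ℕ)

lemma smul_extMk (r : R) (f : P.complex.X n ⟶ Y) (hf : P.complex.d (n+1) n ≫ f = 0) :
    r • P.extMk f (n+1) rfl hf = P.extMk (r • f) (n+1) rfl (by simp [hf]) := by
  rw [Ext.smul_eq_comp_mk₀, extMk_comp_mk₀]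
  simp

/-- In degree `0` there are no coboundaries. -/
lemma extMk_eq_zero_iff_of_zero (f : P.complex.X 0 ⟶ Y) (hf : P.complex.d 1 0 ≫ f = 0) :
    P.extMk f 1 rfl hf = 0 ↔ f = 0 := by
  refine ⟨fun h => ?_, ?_⟩
  · rw [← P.extEquivCohomologyClass.apply_eq_iff_eq, extEquivCohomologyClass_extMk,
      extEquivCohomologyClass_zero, CochainComplex.HomComplex.CohomologyClass.mk_eq_zero_iff,
      CochainComplex.HomComplex.Cocycle.toSingleMk_mem_coboundaries_iff _ _ _ _ _ 1 (by simp)] at h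
    obtain ⟨g, hg⟩ := h
    have hz : IsZero (P.cochainComplex.X 1) := P.cochainComplex.isZero_of_isStrictlyLE 0 1 (by simp)
    rw [hz.eq_of_src g 0, comp_zero] at hg
    rw [← cancel_epi (P.cochainComplexXIso (-(0:ℕ)) 0 rfl).hom, comp_zero]
    exact hg.symm
  · rintro rfl
    simp

/-- A cycle of `Hom(P, Y)` in degree `n`, seen as a morphism `Pₙ ⟶ Y`. -/
def cocycle : (P.complex.linearYonedaObj R Y).cycles n →ₗ[R] (P.complex.X n ⟶ Y) :=
  ((P.complex.linearYonedaObj R Y).iCycles n).hom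

lemma d_comp_cocycle (z : (P.complex.linearYonedaObj R Y).cycles n) :
    P.complex.d (n+1) n ≫ P.cocycle Y n z = 0 :=
  CochainHomology.d_iCycles (P.complex.linearYonedaObj R Y) n z

/-- The class in `Ext^n(X, Y)` of a cycle of `Hom(P, Y)`, for a projective resolution `P` of `X`. -/
def cyclesToExt : (P.complex.linearYonedaObj R Y).cycles n →ₗ[R] Abelian.Ext X Y n where
  toFun z := P.extMk (P.cocycle Y n z) (n+1) rfl (P.d_comp_cocycle Y n z)
  map_add' x y := by simp only [add_extMk, map_add]
  map_smul' r x := by simp only [smul_extMk, map_smul, RingHom.id_apply]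

lemma cyclesToExt_apply (z : (P.complex.linearYonedaObj R Y).cycles n) :
    P.cyclesToExt Y n z = P.extMk (P.cocycle Y n z) (n+1) rfl (P.d_comp_cocycle Y n z) := rfl

lemma cyclesToExt_surjective : Function.Surjective (P.cyclesToExt Y n) := by
  intro α
  obtain ⟨f, hf, rfl⟩ := P.extMk_surjective α (n+1) rfl
  obtain ⟨z, hz⟩ := CochainHomology.exists_iCycles_eq (P.complex.linearYonedaObj R Y) n f hf
  refine ⟨z, ?_⟩
  have hz' : P.cocycle Y n z = f := hz
  simp only [cyclesToExt_apply, hz']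

/-- A cycle has trivial class in `Ext` exactly when it is a boundary. -/
lemma ker_cyclesToExt : LinearMap.ker (P.cyclesToExt Y n) =
    LinearMap.ker ((P.complex.linearYonedaObj R Y).homologyπ n).hom := by
  ext z
  rw [LinearMap.mem_ker, LinearMap.mem_ker]
  rw [cyclesToExt_apply]
  cases n with
  | zero =>
    rw [extMk_eq_zero_iff_of_zero]
    refine ⟨fun h => CochainHomology.homologyπ_eq_zero _ 0 z 0 0 ?_, fun h => ?_⟩
    · rw [map_zero]; exact h.symm
    · obtain ⟨w, hw⟩ := CochainHomology.exists_d_eq_of_homologyπ_eq_zero _ _ z h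
      rw [HomologicalComplex.shape _ _ _ (by simp)] at hw
      exact hw.symm
  | succ n =>
    rw [P.extMk_eq_zero_iff _ _ _ _ n rfl]
    refine ⟨fun ⟨g, hg⟩ => CochainHomology.homologyπ_eq_zero _ _ z n g hg, fun h => ?_⟩
    obtain ⟨w, hw⟩ := CochainHomology.exists_d_eq_of_homologyπ_eq_zero _ _ z h
    have : (ComplexShape.up ℕ).prev (n+1) = n := by simp
    generalize (ComplexShape.up ℕ).prev (n+1) = p at this w hw
    subst this
    exact ⟨w, hw⟩

/-- The homology of `Hom(P, Y)` is `Ext^n(X, Y)`: both are the quotient of the cycles by the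
boundaries. -/
def homologyLinearEquivExt : (P.complex.linearYonedaObj R Y).homology n ≃ₗ[R] Abelian.Ext X Y n :=
  (LinearMap.quotKerEquivOfSurjective _ (CochainHomology.homologyπ_surjective _ n)).symm ≪≫ₗ
    (Submodule.quotEquivOfEq _ _ (P.ker_cyclesToExt Y n).symm) ≪≫ₗ
    LinearMap.quotKerEquivOfSurjective _ (P.cyclesToExt_surjective Y n)

lemma homologyLinearEquivExt_π (z : (P.complex.linearYonedaObj R Y).cycles n) :
    P.homologyLinearEquivExt Y n (((P.complex.linearYonedaObj R Y).homologyπ n).hom z) =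
      P.cyclesToExt Y n z := by
  have : (LinearMap.quotKerEquivOfSurjective _
      (CochainHomology.homologyπ_surjective (P.complex.linearYonedaObj R Y) n)).symm
      (((P.complex.linearYonedaObj R Y).homologyπ n).hom z) = Submodule.Quotient.mk z := by
    rw [LinearEquiv.symm_apply_eq]; rfl
  simp only [homologyLinearEquivExt, LinearEquiv.trans_apply, this]
  rfl

lemma homologyLinearEquivExt_naturality {g : X ⟶ X'} (φ : Hom P P' g)
    (x : (P'.complex.linearYonedaObj R Y).homology n) :
    P.homologyLinearEquivExt Y n ((HomologicalComplex.homologyMap (linearYonedaObjMap φ.hom Y)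
        n).hom x) =
      (Abelian.Ext.mk₀ g).comp (P'.homologyLinearEquivExt Y n x) (zero_add n) := by
  obtain ⟨z, rfl⟩ := CochainHomology.homologyπ_surjective _ n x
  have h : (HomologicalComplex.homologyMap (linearYonedaObjMap φ.hom Y) n).hom
      (((P'.complex.linearYonedaObj R Y).homologyπ n).hom z) =
      ((P.complex.linearYonedaObj R Y).homologyπ n).hom
        ((HomologicalComplex.cyclesMap (linearYonedaObjMap φ.hom Y) n).hom z) :=
    congrArg (fun f => f.hom z) (HomologicalComplex.homologyπ_naturality
        (linearYonedaObjMap φ.hom Y) n)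
  rw [h, homologyLinearEquivExt_π, homologyLinearEquivExt_π]
  rw [cyclesToExt_apply, cyclesToExt_apply, mk₀_comp_extMk _ _ _ _ φ]
  congr 1
  exact congrArg (fun f => f.hom z) (HomologicalComplex.cyclesMap_i (linearYonedaObjMap φ.hom Y) n)

end CategoryTheory.ProjectiveResolution

section
variable {X X' : ModuleCat.{u} R} (Y : ModuleCat.{u} R) (n : ℕ)

variable (X) in
/-- The `Ext` defined as a left derived functor of `Hom(-, Y)ᵒᵖ` agrees with the `Ext` defined
through the derived category; both are computed by a projective resolution of `X`. -/
def derivedExtEquiv : ((Ext R (ModuleCat.{u} R) n).obj (op X)).obj Y ≃ₗ[R] Abelian.Ext X Y n :=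
  ((projectiveResolution X).isoExt n Y).toLinearEquiv ≪≫ₗ
    (projectiveResolution X).homologyLinearEquivExt Y n

lemma derivedExtEquiv_apply (x : ((Ext R (ModuleCat.{u} R) n).obj (op X)).obj Y) :
    derivedExtEquiv X Y n x = (projectiveResolution X).homologyLinearEquivExt Y n
      (((projectiveResolution X).isoExt n Y).hom.hom x) := rfl

lemma derivedExtEquiv_naturality (g : X ⟶ X')
    (x : ((Ext R (ModuleCat.{u} R) n).obj (op X')).obj Y) :
    derivedExtEquiv X Y n ((((Ext R (ModuleCat.{u} R) n).map g.op).app Y).hom x) =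
      (Abelian.Ext.mk₀ g).comp (derivedExtEquiv X' Y n x) (zero_add n) := by
  let φ : ProjectiveResolution.Hom (projectiveResolution X) (projectiveResolution X') g :=
    ⟨ProjectiveResolution.lift g _ _, ProjectiveResolution.lift_commutes_zero g _ _⟩
  rw [derivedExtEquiv_apply, derivedExtEquiv_apply,
    ← ProjectiveResolution.homologyLinearEquivExt_naturality _ _ Y n φ]
  congr 1
  rw [← ModuleCat.comp_apply, isoExt_naturality _ _ g φ n Y, ModuleCat.comp_apply]
end

/-! ### The direct limit of `Ext^n(R / I ^ t, N)` and its long exact sequence -/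

namespace LocalCohomologyCofinite
variable (I : Ideal R) (n : ℕ)

/-- The module `R / I ^ t`. -/
def quotPow (t : ℕ) : ModuleCat.{u} R := ModuleCat.of R (R ⧸ I ^ t)

/-- The canonical surjection `R / I ^ t ⟶ R / I ^ s` for `s ≤ t`. -/
def quotPowMap {s t : ℕ} (h : s ≤ t) : quotPow I t ⟶ quotPow I s :=
  ModuleCat.ofHom (Submodule.mapQ _ _ LinearMap.id (Ideal.pow_le_pow_right h))

lemma quotPowMap_self (t : ℕ) : quotPowMap I (le_refl t) = 𝟙 _ := by
  ext : 1
  exact Submodule.linearMap_qext _ rfl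

lemma quotPowMap_comp {r s t : ℕ} (h : r ≤ s) (h' : s ≤ t) :
    quotPowMap I h' ≫ quotPowMap I h = quotPowMap I (h.trans h') := by
  ext : 1
  exact Submodule.linearMap_qext _ rfl

variable (N N' : ModuleCat.{u} R)

/-- The map `Ext^n(R / I ^ s, N) → Ext^n(R / I ^ t, N)` for `s ≤ t`. -/
def extTransition (s t : ℕ) (h : s ≤ t) : Abelian.Ext (quotPow I s) N n →ₗ[R] Abelian.Ext
    (quotPow I t) N n :=
  (Ext.mk₀ (quotPowMap I h)).precompOfLinear R N (zero_add n)

lemma extTransition_apply {s t : ℕ} (h : s ≤ t) (x : Abelian.Ext (quotPow I s) N n) :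
    extTransition I n N s t h x = (Ext.mk₀ (quotPowMap I h)).comp x (zero_add n) := rfl

instance : DirectedSystem (fun t => Abelian.Ext (quotPow I t) N n)
    (fun s t h => extTransition I n N s t h) where
  map_self t x := by simp [extTransition_apply, quotPowMap_self]
  map_map i j k hij hjk x := by
    simp [extTransition_apply, ← quotPowMap_comp I hij hjk]

/-- The direct limit over `t` of `Ext^n(R / I ^ t, N)`, with `Ext` taken in the derived category. It
is isomorphic to Mathlib's `localCohomology` (see `localCohomologyEquiv`), but has a long exact
sequence directly at hand. -/
abbrev ExtLimit : Type u :=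
  Module.DirectLimit (fun t => Abelian.Ext (quotPow I t) N n) (extTransition I n N)

namespace ExtLimit

variable {n N} in
/-- The canonical map from `Ext^n(R / I ^ t, N)` to the direct limit. -/
abbrev of (t : ℕ) : Abelian.Ext (quotPow I t) N n →ₗ[R] ExtLimit I n N :=
  Module.DirectLimit.of R ℕ (fun t => Abelian.Ext (quotPow I t) N n) (extTransition I n N) t

variable {I n N}

lemma exists_of (z : ExtLimit I n N) : ∃ t x, of I t x = z := Module.DirectLimit.exists_of z

lemma of_eq_zero_iff {t : ℕ} (x : Abelian.Ext (quotPow I t) N n) :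
    of I t x = 0 ↔ ∃ s, ∃ h : t ≤ s, (Ext.mk₀ (quotPowMap I h)).comp x (zero_add n) = 0 := by
  refine ⟨fun h => Module.DirectLimit.of.zero_exact h, fun ⟨s, h, hs⟩ => ?_⟩
  have := Module.DirectLimit.of_f (R := R) (f := extTransition I n N) (hij := h) (x := x)
  rw [extTransition_apply, hs, map_zero] at this
  exact this.symm

lemma of_transition {s t : ℕ} (h : s ≤ t) (x : Abelian.Ext (quotPow I s) N n) :
    of I t ((Ext.mk₀ (quotPowMap I h)).comp x (zero_add n)) = of I s x :=
  Module.DirectLimit.of_f (R := R) (f := extTransition I n N) (hij := h) (x := x)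

variable {N'}
variable (I) in
/-- Composition with a class `α ∈ Ext^m(N, N')`, as a map of direct limits. -/
def postcomp {m : ℕ} (n n' : ℕ) (α : Abelian.Ext N N' m) (h : n + m = n') :
    ExtLimit I n N →ₗ[R] ExtLimit I n' N' :=
  Module.DirectLimit.map (G := fun t => Abelian.Ext (quotPow I t) N n)
    (G' := fun t => Abelian.Ext (quotPow I t) N' n') (f := extTransition I n N)
    (f' := extTransition I n' N') (fun t => α.postcompOfLinear R (quotPow I t) h) (by
    intro s t hst
    ext x
    simp only [LinearMap.comp_apply, extTransition_apply, Ext.postcompOfLinear,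
        LinearMap.flip_apply,
      Ext.bilinearCompOfLinear_apply_apply]
    rw [Ext.comp_assoc _ _ _ (zero_add n) h (by omega)])

@[simp]
lemma postcomp_of {m : ℕ} {n n' : ℕ} (α : Abelian.Ext N N' m) (h : n + m = n') (t : ℕ)
    (x : Abelian.Ext (quotPow I t) N n) :
    postcomp I n n' α h (of I t x) = of I t (x.comp α h) :=
  Module.DirectLimit.map_apply_of (G := fun t => Abelian.Ext (quotPow I t) N n)
    (G' := fun t => Abelian.Ext (quotPow I t) N' n') (f := extTransition I n N)
    (f' := extTransition I n' N') (fun t => α.postcompOfLinear R (quotPow I t) h) _ x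

variable {S : ShortComplex (ModuleCat.{u} R)} (hS : S.ShortExact)
variable (I) in
/-- Functoriality of `ExtLimit` in the module. -/
abbrev map (n : ℕ) (f : N ⟶ N') : ExtLimit I n N →ₗ[R] ExtLimit I n N' :=
    postcomp I n n (Ext.mk₀ f) (add_zero n)

variable (I) in
/-- The connecting homomorphism of a short exact sequence. -/
abbrev δ (hS : S.ShortExact) (n : ℕ) : ExtLimit I n S.X₃ →ₗ[R] ExtLimit I (n+1) S.X₁ :=
    postcomp I n (n+1) hS.extClass rfl

include hS in
lemma exact_map_map (n : ℕ) : Function.Exact (map I n S.f) (map I n S.g) := by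
  intro z
  obtain ⟨t, x, rfl⟩ := exists_of z
  constructor
  · rw [postcomp_of, of_eq_zero_iff]
    rintro ⟨s, h, hs⟩
    rw [← Ext.comp_assoc _ _ _ (zero_add n) (add_zero n) (by omega)] at hs
    obtain ⟨y, hy⟩ := Ext.covariant_sequence_exact₂ _ hS _ hs
    exact ⟨of I s y, by rw [postcomp_of, hy, of_transition]⟩
  · rintro ⟨y, hy⟩
    rw [← hy]
    obtain ⟨s, y, rfl⟩ := exists_of y
    simp

lemma exact_map_δ (n : ℕ) : Function.Exact (map I n S.g) (δ I hS n) := by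
  intro z
  obtain ⟨t, x, rfl⟩ := exists_of z
  constructor
  · rw [postcomp_of, of_eq_zero_iff]
    rintro ⟨s, h, hs⟩
    rw [← Ext.comp_assoc _ _ _ (zero_add n) rfl (by omega)] at hs
    obtain ⟨y, hy⟩ := Ext.covariant_sequence_exact₃ _ hS _ _ hs
    exact ⟨of I s y, by rw [postcomp_of, hy, of_transition]⟩
  · rintro ⟨y, hy⟩
    rw [← hy]
    obtain ⟨s, y, rfl⟩ := exists_of y
    simp

lemma exact_δ_map (n : ℕ) : Function.Exact (δ I hS n) (map I (n+1) S.f) := by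
  intro z
  obtain ⟨t, x, rfl⟩ := exists_of z
  constructor
  · rw [postcomp_of, of_eq_zero_iff]
    rintro ⟨s, h, hs⟩
    rw [← Ext.comp_assoc _ _ _ (zero_add _) (add_zero _) (by omega)] at hs
    obtain ⟨y, hy⟩ := Ext.covariant_sequence_exact₁ _ hS _ hs rfl
    exact ⟨of I s y, by rw [postcomp_of, hy, of_transition]⟩
  · rintro ⟨y, hy⟩
    rw [← hy]
    obtain ⟨s, y, rfl⟩ := exists_of y
    simp

instance subsingleton_of_injective [Injective N] (n : ℕ) : Subsingleton (ExtLimit I (n+1) N) := by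
  refine subsingleton_of_forall_eq 0 fun z => ?_
  obtain ⟨t, x, rfl⟩ := exists_of z
  rw [Ext.eq_zero_of_injective x, map_zero]

lemma map_smul_id (r : R) (n : ℕ) (z : ExtLimit I n N) : map I n (r • 𝟙 N) z = r • z := by
  obtain ⟨t, x, rfl⟩ := exists_of z
  rw [postcomp_of, ← Ext.smul_eq_comp_mk₀, map_smul]

lemma smul_eq_zero_of_mem {t : ℕ} {r : R} (hr : r ∈ I ^ t) (x : Abelian.Ext (quotPow I t) N n) :
    r • x = 0 := by
  have : r • 𝟙 (quotPow I t) = 0 := by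
    ext : 1
    refine Submodule.linearMap_qext _ (LinearMap.ext_ring ?_)
    exact (Submodule.Quotient.mk_eq_zero _).2 (by simpa using hr)
  rw [← Ext.mk₀_id_comp (r • x), Ext.comp_smul, ← Ext.smul_comp, ← Ext.mk₀_smul, this]
  simp

end ExtLimit

/-! ### Comparison with local cohomology -/
/-- `ExtLimit I n N` as a cocone over the diagram defining local cohomology, evaluated at `N`. -/
def extLimitCocone : Cocone (localCohomology.diagram (localCohomology.idealPowersDiagram I) n ⋙
    (evaluation (ModuleCat.{u} R) (ModuleCat.{u} R)).obj N) where
  pt := ModuleCat.of R (ExtLimit I n N)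
  ι := { app t := ModuleCat.ofHom (ExtLimit.of I t.unop.unop ∘ₗ
      (derivedExtEquiv (quotPow I t.unop.unop) N n).toLinearMap)
         naturality s t f := by
          ext x
          refine (congrArg (ExtLimit.of I t.unop.unop) (derivedExtEquiv_naturality N n
            (quotPowMap I f.unop.unop.down.down) x)).trans ?_
          exact ExtLimit.of_transition _ _ }

variable {I n N} in
/-- The components of a cocone over the diagram of derived-functor `Ext`s, transported to the
derived-category `Ext`s. -/
def coconeComponent (s : Cocone (localCohomology.diagram (localCohomology.idealPowersDiagram I) n ⋙
    (evaluation (ModuleCat.{u} R) (ModuleCat.{u} R)).obj N)) (t : ℕ) :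
    Abelian.Ext (quotPow I t) N n →ₗ[R] s.pt :=
  LinearMap.comp (M₂ := ((Ext R (ModuleCat.{u} R) n).obj (op (quotPow I t))).obj N)
    (s.ι.app (op (op t))).hom (derivedExtEquiv (quotPow I t) N n).symm.toLinearMap

variable {I n N} in
lemma coconeComponent_derivedExtEquiv (s : Cocone (localCohomology.diagram
    (localCohomology.idealPowersDiagram I) n ⋙
    (evaluation (ModuleCat.{u} R) (ModuleCat.{u} R)).obj N)) (t : ℕ) (x) :
    coconeComponent s t (derivedExtEquiv (quotPow I t) N n x) = (s.ι.app (op (op t))).hom x :=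
  congrArg (s.ι.app (op (op t))).hom (LinearEquiv.symm_apply_apply _ x)

variable {I n N} in
/-- The map out of `ExtLimit` induced by a cocone. -/
def descCocone (s : Cocone (localCohomology.diagram (localCohomology.idealPowersDiagram I) n ⋙
    (evaluation (ModuleCat.{u} R) (ModuleCat.{u} R)).obj N)) : ExtLimit I n N →ₗ[R] s.pt :=
  Module.DirectLimit.lift R ℕ (fun t => Abelian.Ext (quotPow I t) N n) (extTransition I n N)
      (coconeComponent s) (by
      intro i j hij x
      obtain ⟨x, rfl⟩ := (derivedExtEquiv (quotPow I i) N n).surjective x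
      have := derivedExtEquiv_naturality N n (quotPowMap I hij) x
      rw [extTransition_apply, ← this, coconeComponent_derivedExtEquiv,
        coconeComponent_derivedExtEquiv]
      exact congrArg (fun f => f.hom x) (s.w (homOfLE hij).op.op))

variable {I n N} in
lemma descCocone_of (s : Cocone (localCohomology.diagram (localCohomology.idealPowersDiagram I) n ⋙
    (evaluation (ModuleCat.{u} R) (ModuleCat.{u} R)).obj N)) (t : ℕ) (x) :
    descCocone s (ExtLimit.of I t x) = coconeComponent s t x :=
  Module.DirectLimit.lift_of (G := fun t => Abelian.Ext (quotPow I t) N n)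
      (f := extTransition I n N) (coconeComponent s) _ x

/-- `ExtLimit I n N` is a colimit of the diagram defining local cohomology, evaluated at `N`. -/
def isColimitExtLimitCocone : IsColimit (extLimitCocone I n N) where
  desc s := ModuleCat.ofHom (descCocone s)
  fac s t := by
    ext x
    exact (descCocone_of s _ _).trans (coconeComponent_derivedExtEquiv _ _ _)
  uniq s m hm := by
    ext z
    obtain ⟨t, x, rfl⟩ := ExtLimit.exists_of z
    obtain ⟨x, rfl⟩ := (derivedExtEquiv (quotPow I t) N n).surjective x
    refine Eq.trans ?_ ((descCocone_of s _ _).trans (coconeComponent_derivedExtEquiv _ _ _)).symm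
    exact congrArg (fun f => f.hom x) (hm (op (op t)))

/-- Local cohomology is the direct limit of the modules `Ext^n(R / I ^ t, N)`. -/
def localCohomologyEquiv : (localCohomology I n).obj N ≃ₗ[R] ExtLimit I n N :=
  (colimitObjIsoColimitCompEvaluation
    (localCohomology.diagram (localCohomology.idealPowersDiagram I) n) N ≪≫
    (colimit.isColimit _).coconePointUniqueUpToIso (isColimitExtLimitCocone I n N)).toLinearEquiv
end LocalCohomologyCofinite

/-! ### Ideal torsion -/

namespace LocalCohomologyCofinite
variable (I : Ideal R)

section torsion
variable (A : Type*) [AddCommGroup A] [Module R A]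
/-- The `I`-torsion submodule `Γ_I(A)`: the elements killed by a power of `I`. -/
def idealTorsion : Submodule R A where
  carrier := {x | ∃ k, ∀ r ∈ I ^ k, r • x = 0}
  add_mem' := by
    rintro x y ⟨k, hk⟩ ⟨l, hl⟩
    refine ⟨k + l, fun r hr => ?_⟩
    rw [smul_add, hk r (Ideal.pow_le_pow_right (by omega) hr),
        hl r (Ideal.pow_le_pow_right (by omega) hr), add_zero]
  zero_mem' := ⟨0, by simp⟩
  smul_mem' := by
    rintro c x ⟨k, hk⟩
    exact ⟨k, fun r hr => by rw [smul_comm, hk r hr, smul_zero]⟩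

/-- `A` is `I`-torsion if each of its elements is killed by a power of `I`. -/
def IsIdealTorsion : Prop := ∀ x : A, ∃ k, ∀ r ∈ I ^ k, r • x = 0

variable {A I}
lemma isIdealTorsion_idealTorsion : IsIdealTorsion I (idealTorsion I A) := fun x => by
  obtain ⟨k, hk⟩ := x.2
  exact ⟨k, fun r hr => Subtype.ext (hk r hr)⟩

variable {B : Type*} [AddCommGroup B] [Module R B]
lemma IsIdealTorsion.of_surjective (h : IsIdealTorsion I A) (f : A →ₗ[R] B)
    (hf : Function.Surjective f) :
    IsIdealTorsion I B := fun b => by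
  obtain ⟨a, rfl⟩ := hf b
  obtain ⟨k, hk⟩ := h a
  exact ⟨k, fun r hr => by rw [← map_smul, hk r hr, map_zero]⟩

lemma IsIdealTorsion.of_injective (h : IsIdealTorsion I B) (f : A →ₗ[R] B)
    (hf : Function.Injective f) :
    IsIdealTorsion I A := fun a => by
  obtain ⟨k, hk⟩ := h (f a)
  exact ⟨k, fun r hr => hf (by rw [map_smul, hk r hr, map_zero])⟩

lemma map_mem_idealTorsion (f : A →ₗ[R] B) {x : A} (hx : x ∈ idealTorsion I A) :
    f x ∈ idealTorsion I B := by
  obtain ⟨k, hk⟩ := hx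
  exact ⟨k, fun r hr => by rw [← map_smul, hk r hr, map_zero]⟩

lemma idealTorsion_quotient_eq_bot [IsNoetherianRing R] :
    idealTorsion I (A ⧸ idealTorsion I A) = ⊥ := by
  rw [eq_bot_iff]
  intro x hx
  obtain ⟨a, rfl⟩ := Submodule.Quotient.mk_surjective _ x
  obtain ⟨k, hk⟩ := hx
  obtain ⟨s, hs⟩ : (I ^ k).FG := IsNoetherian.noetherian _
  have h1 : ∀ r ∈ s, ∃ l, ∀ c ∈ I ^ l, c • r • a = 0 := fun r hr => by
    have := hk r (hs ▸ Submodule.subset_span hr)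
    rw [← Submodule.Quotient.mk_smul, Submodule.Quotient.mk_eq_zero] at this
    exact this
  choose! l hl using h1
  rw [Submodule.mem_bot, Submodule.Quotient.mk_eq_zero]
  refine ⟨s.sup l + k, fun c hc => ?_⟩
  rw [pow_add] at hc
  refine Submodule.mul_induction_on hc (fun m hm n hn => ?_)
      (fun x y hx hy => by rw [add_smul, hx, hy, add_zero])
  rw [← hs] at hn
  rw [mul_smul]
  induction hn using Submodule.span_induction with
  | mem x hx => exact hl x hx m (Ideal.pow_le_pow_right (Finset.le_sup hx) hm)
  | zero => simp
  | add x y _ _ hx hy => rw [add_smul, smul_add, hx, hy, add_zero]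
  | smul c x _ hx => rw [smul_eq_mul, mul_smul, smul_comm, hx, smul_zero]

/-! ### Torsion of injective modules -/
variable (I) in
/-- Over a Noetherian ring `Γ_I` preserves injectivity. Given `g : J → Γ_I(E)`, some `I ^ k` kills
the image of `g`, so by Artin–Rees `g` factors through the image of `J` in `R / I ^ (m + k)`;
extending that factorization to `R / I ^ (m + k)` with values in `E` gives values in `Γ_I(E)`. -/
lemma injective_idealTorsion [IsNoetherianRing R] (E : Type u) [AddCommGroup E] [Module R E]
    [Module.Injective R E] :
    Module.Injective R (idealTorsion I E) := by
  refine Module.Baer.injective fun J g => ?_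
  -- a power of `I` kills the image of the finitely generated ideal `J`
  obtain ⟨k, hk⟩ : ∃ k, ∀ c ∈ I ^ k, ∀ j : J, c • g j = 0 := by
    obtain ⟨s, hs⟩ : (⊤ : Submodule R J).FG := IsNoetherian.noetherian _
    have h1 : ∀ j : J, ∃ l, ∀ c ∈ I ^ l, c • g j = 0 := fun j => isIdealTorsion_idealTorsion (g j)
    choose l hl using h1
    refine ⟨s.sup l, fun c hc j => ?_⟩
    have hj : j ∈ (⊤ : Submodule R J) := trivial
    rw [← hs] at hj
    induction hj using Submodule.span_induction with
    | mem x hx => exact hl x c (Ideal.pow_le_pow_right (Finset.le_sup hx) hc)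
    | zero => simp
    | add x y _ _ hx hy => rw [map_add, smul_add, hx, hy, add_zero]
    | smul d x _ hx => rw [map_smul, smul_comm, hx, smul_zero]
  obtain ⟨m, hm⟩ := Ideal.exists_pow_inf_eq_pow_smul I (J : Submodule R R)
  -- `g` vanishes on `J ∩ I ^ (m + k)`
  have hg : ∀ j : J, (j : R) ∈ I ^ (m + k) → g j = 0 := by
    intro j hj
    have h1 : (j : R) ∈ I ^ k • (I ^ m • ⊤ ⊓ J : Submodule R R) := by
      have := hm (m + k) (by omega)
      rw [Nat.add_sub_cancel_left] at this
      rw [← this]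
      exact ⟨by simpa using hj, j.2⟩
    have h2 : ∀ x ∈ I ^ k • (I ^ m • ⊤ ⊓ J : Submodule R R), ∃ hx : x ∈ J, g ⟨x, hx⟩ = 0 := by
      intro x hx
      refine Submodule.smul_induction_on hx (fun r hr n hn => ?_) (fun x y hx hy => ?_)
      · exact ⟨J.smul_mem r hn.2, (map_smul g r ⟨n, hn.2⟩).trans (hk r hr _)⟩
      · obtain ⟨hx, hx'⟩ := hx
        obtain ⟨hy, hy'⟩ := hy
        exact ⟨J.add_mem hx hy, (map_add g ⟨x, hx⟩ ⟨y, hy⟩).trans (by rw [hx', hy', add_zero])⟩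
    exact (h2 j h1).2
  let f : J →ₗ[R] R ⧸ I ^ (m + k) := (Submodule.mkQ _) ∘ₗ J.subtype
  let J' := LinearMap.range f
  have hker : LinearMap.ker f.rangeRestrict ≤ LinearMap.ker g := by
    intro j hj
    rw [LinearMap.ker_rangeRestrict, LinearMap.mem_ker] at hj
    exact hg j ((Submodule.Quotient.mk_eq_zero _).1 hj)
  obtain ⟨g', hg'⟩ : ∃ g' : J' →ₗ[R] idealTorsion I E, ∀ j, g' (f.rangeRestrict j) = g j := by
    refine ⟨(LinearMap.ker f.rangeRestrict).liftQ g hker ∘ₗ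
        (f.rangeRestrict.quotKerEquivOfSurjective f.surjective_rangeRestrict).symm.toLinearMap,
        fun j => ?_⟩
    have : (f.rangeRestrict.quotKerEquivOfSurjective f.surjective_rangeRestrict).symm
        (f.rangeRestrict j) = Submodule.Quotient.mk j := by
      rw [LinearEquiv.symm_apply_eq]; rfl
    rw [LinearMap.comp_apply, LinearEquiv.coe_coe, this]
    rfl
  obtain ⟨h, hh⟩ := Module.Injective.out J'.subtype J'.injective_subtype
      ((idealTorsion I E).subtype ∘ₗ g')
  have hmem : ∀ x, h x ∈ idealTorsion I E := by
    intro x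
    refine map_mem_idealTorsion h ⟨m + k, fun r hr => ?_⟩
    obtain ⟨x, rfl⟩ := Submodule.Quotient.mk_surjective _ x
    rw [← Submodule.Quotient.mk_smul, Submodule.Quotient.mk_eq_zero, smul_eq_mul]
    exact Ideal.mul_mem_right _ _ hr
  refine ⟨h.codRestrict _ hmem ∘ₗ Submodule.mkQ _, fun x hx => Subtype.ext ?_⟩
  exact (hh (f.rangeRestrict ⟨x, hx⟩)).trans (congrArg Subtype.val (hg' ⟨x, hx⟩))

/-- An injective submodule of an injective module is a direct summand, so the quotient is injective.
-/
lemma injective_quotient_of_injective (E : Type u) [AddCommGroup E] [Module R E]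
    [Module.Injective R E]
    (B : Submodule R E) [Module.Injective R B] : Module.Injective R (E ⧸ B) := by
  obtain ⟨r, hr⟩ := Module.Injective.out (Q := B) B.subtype B.injective_subtype LinearMap.id
  let s : E ⧸ B →ₗ[R] E := B.liftQ (LinearMap.id - B.subtype ∘ₗ r) (by
    intro x hx
    have := congrArg Subtype.val (hr ⟨x, hx⟩)
    rw [LinearMap.mem_ker, LinearMap.sub_apply, sub_eq_zero]
    exact this.symm)
  refine ⟨fun X Y _ _ _ _ f hf g => ?_⟩
  obtain ⟨h, hh⟩ := Module.Injective.out f hf (s ∘ₗ g)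
  refine ⟨B.mkQ ∘ₗ h, fun x => ?_⟩
  rw [LinearMap.comp_apply, hh, LinearMap.comp_apply]
  obtain ⟨e, he⟩ := B.mkQ_surjective (g x)
  rw [← he]
  change B.mkQ (e - (r e : E)) = B.mkQ e
  rw [map_sub, sub_eq_self]
  exact (Submodule.Quotient.mk_eq_zero _).2 (r e).2

lemma exists_injective_embedding (A : Type u) [AddCommGroup A] [Module R A] :
    ∃ (E : Type u) (_ : AddCommGroup E) (_ : Module R E) (f : A →ₗ[R] E),
        Module.Injective R E ∧ Function.Injective f :=
  ⟨(Injective.under (ModuleCat.of R A) : ModuleCat.{u} R), inferInstance, inferInstance,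
      (Injective.ι (ModuleCat.of R A)).hom,
    Module.injective_module_of_injective_object (inj :=
        (inferInstance : Injective (Injective.under (ModuleCat.of R A)))) _ _,
        (ModuleCat.mono_iff_injective _).1 inferInstance⟩

lemma exists_injective_embedding_of_isIdealTorsion [IsNoetherianRing R] (A : Type u)
    [AddCommGroup A] [Module R A] (hA : IsIdealTorsion I A) :
    ∃ (E : Type u) (_ : AddCommGroup E) (_ : Module R E) (f : A →ₗ[R] E),
        Module.Injective R E ∧ Function.Injective f ∧ IsIdealTorsion I E := by
  obtain ⟨E, _, _, f, hE, hf⟩ := exists_injective_embedding (R := R) A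
  exact ⟨idealTorsion I E, inferInstance, inferInstance, f.codRestrict _ fun a =>
      map_mem_idealTorsion f (hA a),
    injective_idealTorsion I E, fun a b h => hf (congrArg Subtype.val h),
        isIdealTorsion_idealTorsion⟩

lemma exists_injective_embedding_of_idealTorsion_eq_bot [IsNoetherianRing R] (A : Type u)
    [AddCommGroup A] [Module R A] (hA : idealTorsion I A = ⊥) :
    ∃ (E : Type u) (_ : AddCommGroup E) (_ : Module R E) (f : A →ₗ[R] E),
        Module.Injective R E ∧ Function.Injective f ∧ idealTorsion I E = ⊥ := by
  obtain ⟨E, _, _, f, hE, hf⟩ := exists_injective_embedding (R := R) A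
  have := injective_idealTorsion I E
  refine ⟨E ⧸ idealTorsion I E, inferInstance, inferInstance, (idealTorsion I E).mkQ ∘ₗ f,
      injective_quotient_of_injective _ _, ?_, idealTorsion_quotient_eq_bot⟩
  rw [← LinearMap.ker_eq_bot, eq_bot_iff]
  intro a ha
  obtain ⟨k, hk⟩ := (Submodule.Quotient.mk_eq_zero _).1 ha
  rw [← hA]
  exact ⟨k, fun r hr => hf (by rw [map_smul, hk r hr, map_zero])⟩

end torsion

end LocalCohomologyCofinite

namespace LocalCohomologyCofinite
variable {I : Ideal R}

/-! ### Short exact sequences of modules -/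

section
variable {A B C : Type u} [AddCommGroup A] [AddCommGroup B] [AddCommGroup C] [Module R A]
    [Module R B] [Module R C]

lemma shortExact_moduleCatMk {f : A →ₗ[R] B} {g : B →ₗ[R] C} (h : Function.Exact f g)
    (hf : Function.Injective f) (hg : Function.Surjective g) :
    (ShortComplex.moduleCatMk f g h.linearMap_comp_eq_zero).ShortExact where
  exact := (ShortComplex.moduleCat_exact_iff _).2 fun x hx => (h x).1 hx
  mono_f := (ModuleCat.mono_iff_injective _).2 hf
  epi_g := (ModuleCat.epi_iff_surjective _).2 hg

lemma finite_of_exact [IsNoetherianRing R] {A B C : Type*} [AddCommGroup A] [AddCommGroup B]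
    [AddCommGroup C] [Module R A] [Module R B] [Module R C]
  {f : A →ₗ[R] B} {g : B →ₗ[R] C} (h : Function.Exact f g) [Module.Finite R A] [Module.Finite R C]
      : Module.Finite R B := by
  have : IsNoetherian R B := isNoetherian_of_range_eq_ker f g h.linearMap_ker_eq.symm
  infer_instance
end

/-! ### Modules with finitely generated `Ext` from `R / I` -/

section ExtExact
variable {S : ShortComplex (ModuleCat.{u} R)} (hS : S.ShortExact) (X : ModuleCat.{u} R)

include hS in
lemma ext_exact₂ (n : ℕ) : Function.Exact ((Ext.mk₀ S.f).postcompOfLinear R X (add_zero n))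
    ((Ext.mk₀ S.g).postcompOfLinear R X (add_zero n)) := by
  intro z
  constructor
  · exact Ext.covariant_sequence_exact₂ X hS z
  · rintro ⟨y, rfl⟩
    simp

lemma ext_exact₃ (n : ℕ) : Function.Exact ((Ext.mk₀ S.g).postcompOfLinear R X (add_zero n))
    (hS.extClass.postcompOfLinear R X (rfl : n + 1 = n + 1)) := by
  intro z
  constructor
  · exact Ext.covariant_sequence_exact₃ X hS z rfl
  · rintro ⟨y, rfl⟩
    simp

lemma ext_exact₁ (n : ℕ) : Function.Exact (hS.extClass.postcompOfLinear R X (rfl : n + 1 = n + 1))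
    ((Ext.mk₀ S.f).postcompOfLinear R X (add_zero (n+1))) := by
  intro z
  constructor
  · exact fun h => Ext.covariant_sequence_exact₁ X hS z h rfl
  · rintro ⟨y, rfl⟩
    simp
end ExtExact

section HasFiniteExt
/-- All the modules `Ext^i(R / I, N)` are finitely generated. This is `I`-cofiniteness without the
condition on the support, which is automatic for local cohomology modules. -/
def HasFiniteExt (I : Ideal R) (N : ModuleCat.{u} R) : Prop :=
  ∀ i : ℕ, Module.Finite R (Abelian.Ext (ModuleCat.of R (R ⧸ I)) N i)

lemma HasFiniteExt.of_finite [IsNoetherianRing R] (N : ModuleCat.{u} R) [Module.Finite R N] :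
    HasFiniteExt I N := fun _ =>
  inferInstance

lemma HasFiniteExt.of_iso {N N' : ModuleCat.{u} R} (h : HasFiniteExt I N) (e : N ≅ N') :
    HasFiniteExt I N' := fun i => by
  have := h i
  refine Module.Finite.of_surjective ((Ext.mk₀ e.hom).postcompOfLinear R (ModuleCat.of R (R ⧸ I))
      (add_zero i)) fun x =>
    ⟨x.comp (Ext.mk₀ e.inv) (add_zero i), ?_⟩
  simp

lemma HasFiniteExt.of_linearEquiv {N N' : Type u} [AddCommGroup N] [AddCommGroup N'] [Module R N]
    [Module R N']
    (h : HasFiniteExt I (ModuleCat.of R N)) (e : N ≃ₗ[R] N') :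
        HasFiniteExt I (ModuleCat.of R N') := h.of_iso e.toModuleIso

variable [IsNoetherianRing R] {S : ShortComplex (ModuleCat.{u} R)} (hS : S.ShortExact)
include hS
lemma HasFiniteExt.X₂ (h₁ : HasFiniteExt I S.X₁) (h₃ : HasFiniteExt I S.X₃) :
    HasFiniteExt I S.X₂ := fun i => by
  have := h₁ i
  have := h₃ i
  exact finite_of_exact (ext_exact₂ hS _ i)

lemma HasFiniteExt.X₃ (h₁ : HasFiniteExt I S.X₁) (h₂ : HasFiniteExt I S.X₂) :
    HasFiniteExt I S.X₃ := fun i => by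
  have := h₁ (i+1)
  have := h₂ i
  exact finite_of_exact (ext_exact₃ hS _ i)

lemma HasFiniteExt.X₁ (h₂ : HasFiniteExt I S.X₂) (h₃ : HasFiniteExt I S.X₃) :
    HasFiniteExt I S.X₁ := fun i => by
  cases i with
  | zero =>
    have := h₂ 0
    have := hS.mono_f
    exact Module.Finite.of_injective ((Ext.mk₀ S.f).postcompOfLinear R (ModuleCat.of R (R ⧸ I))
        (add_zero 0))
      (Ext.postcomp_mk₀_injective_of_mono _ S.f)
  | succ i =>
    have := h₂ (i+1)
    have := h₃ i
    exact finite_of_exact (ext_exact₁ hS _ i)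
end HasFiniteExt

/-! ### Local cohomology in degree zero and of torsion modules -/

namespace ExtLimit
section eval
variable (I) (N : ModuleCat.{u} R)
/-- Evaluation `Hom(R / I ^ t, N) → N` at the class of `1`. -/
def evalOne (t : ℕ) : Abelian.Ext (quotPow I t) N 0 →ₗ[R] N where
  toFun x := (Ext.linearEquiv₀ (R := R) x).hom (Submodule.Quotient.mk (1 : R) : R ⧸ I ^ t)
  map_add' x y := by rw [map_add]; rfl
  map_smul' r x := by rw [map_smul]; rfl

variable {I N}

lemma evalOne_mk₀ {t : ℕ} (f : quotPow I t ⟶ N) : evalOne I N t (Ext.mk₀ f) = f.hom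
    (Submodule.Quotient.mk (1 : R) : R ⧸ I ^ t) := by
  have : Ext.linearEquiv₀ (R := R) (Ext.mk₀ f) = f := Ext.linearEquiv₀.apply_symm_apply f
  simp only [evalOne, LinearMap.coe_mk, AddHom.coe_mk, this]

lemma exists_mk₀_eq {t : ℕ} (x : Abelian.Ext (quotPow I t) N 0) : ∃ f, Ext.mk₀ f = x :=
  ⟨_, Ext.mk₀_linearEquiv₀_apply (R := R) x⟩

variable (I N) in
/-- The evaluations at `1` assembled into a map on the direct limit. -/
def eval : ExtLimit I 0 N →ₗ[R] N :=
  Module.DirectLimit.lift R ℕ (fun t => Abelian.Ext (quotPow I t) N 0) (extTransition I 0 N)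
      (evalOne I N) (by
    intro s t h x
    obtain ⟨f, rfl⟩ := exists_mk₀_eq x
    rw [extTransition_apply, Ext.mk₀_comp_mk₀, evalOne_mk₀, evalOne_mk₀]
    rfl)

lemma eval_of_mk₀ {t : ℕ} (f : quotPow I t ⟶ N) : eval I N (of I t (Ext.mk₀ f)) = f.hom
    (Submodule.Quotient.mk (1 : R) : R ⧸ I ^ t) :=
  (Module.DirectLimit.lift_of (G := fun t => Abelian.Ext (quotPow I t) N 0)
      (f := extTransition I 0 N) (evalOne I N) _ _).trans (evalOne_mk₀ f)

lemma eval_map {N' : ModuleCat.{u} R} (g : N ⟶ N') (z : ExtLimit I 0 N) :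
    eval I N' (map I 0 g z) = g.hom (eval I N z) := by
  obtain ⟨t, x, rfl⟩ := exists_of z
  obtain ⟨f, rfl⟩ := exists_mk₀_eq x
  rw [postcomp_of, Ext.mk₀_comp_mk₀, eval_of_mk₀, eval_of_mk₀]
  rfl

lemma eval_injective : Function.Injective (eval I N) := by
  rw [injective_iff_map_eq_zero]
  intro z hz
  obtain ⟨t, x, rfl⟩ := exists_of z
  obtain ⟨f, rfl⟩ := exists_mk₀_eq x
  rw [eval_of_mk₀] at hz
  have : f = 0 := by
    ext : 1
    exact Submodule.linearMap_qext _ (LinearMap.ext_ring hz)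
  rw [this, Ext.mk₀_zero, map_zero]

lemma range_eval : LinearMap.range (eval I N) = idealTorsion I N := by
  apply le_antisymm
  · rintro _ ⟨z, rfl⟩
    obtain ⟨t, x, rfl⟩ := exists_of z
    refine ⟨t, fun r hr => ?_⟩
    rw [← map_smul, ← map_smul, smul_eq_zero_of_mem hr, map_zero, map_zero]
  · rintro x ⟨t, ht⟩
    let f : quotPow I t ⟶ N := ModuleCat.ofHom ((I ^ t).liftQ (LinearMap.toSpanSingleton R N x)
        fun r hr => ht r hr)
    refine ⟨of I t (Ext.mk₀ f), ?_⟩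
    rw [eval_of_mk₀]
    exact one_smul R x

variable (I N) in
/-- In degree `0` the direct limit is the `I`-torsion submodule. -/
def equivIdealTorsion : ExtLimit I 0 N ≃ₗ[R] idealTorsion I N :=
  LinearEquiv.ofInjective _ eval_injective ≪≫ₗ LinearEquiv.ofEq _ _ range_eval

lemma isIdealTorsion (n : ℕ) : IsIdealTorsion I (ExtLimit I n N) := fun z => by
  obtain ⟨t, x, rfl⟩ := exists_of z
  exact ⟨t, fun r hr => by rw [← map_smul, smul_eq_zero_of_mem hr, map_zero]⟩

lemma eval_surjective_of_isIdealTorsion (h : IsIdealTorsion I N) :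
    Function.Surjective (eval I N) := by
  rw [← LinearMap.range_eq_top, range_eval, eq_top_iff]
  exact fun x _ => h x

lemma subsingleton_zero (h : idealTorsion I N = ⊥) : Subsingleton (ExtLimit I 0 N) := by
  have : Subsingleton (idealTorsion I N) := by rw [h]; infer_instance
  exact (equivIdealTorsion I N).toEquiv.subsingleton

end eval

/-- An `I`-torsion module has no local cohomology in positive degrees: embed it into an `I`-torsion
injective module `E`; in degree `1` use that `H⁰(E) = E → E / T = H⁰(E / T)` is surjective, then
shift the degree. -/
theorem subsingleton_of_isIdealTorsion [IsNoetherianRing R] (n : ℕ) (T : Type u) [AddCommGroup T]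
    [Module R T] (hT : IsIdealTorsion I T) :
    Subsingleton (ExtLimit I (n+1) (ModuleCat.of R T)) := by
  induction n generalizing T with
  | zero =>
    obtain ⟨E, _, _, f, hE, hf, hEt⟩ := exists_injective_embedding_of_isIdealTorsion T hT
    have hS := shortExact_moduleCatMk (LinearMap.exact_map_mkQ_range f) hf
        (Submodule.mkQ_surjective _)
    have : Injective (ModuleCat.of R E) := Module.injective_object_of_injective_module R E
    have hsub : Subsingleton (ExtLimit I 1 (ModuleCat.of R E)) := subsingleton_of_injective 0
    refine subsingleton_of_forall_eq 0 fun z => ?_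
    obtain ⟨w, rfl⟩ := (exact_δ_map hS 0 z).1 (Subsingleton.elim (h := hsub) _ _)
    refine (exact_map_δ hS 0 w).2 ?_
    obtain ⟨e, he⟩ := Submodule.mkQ_surjective (LinearMap.range f) (eval I _ w)
    obtain ⟨y, rfl⟩ := eval_surjective_of_isIdealTorsion (N := ModuleCat.of R E) hEt e
    exact ⟨y, eval_injective ((eval_map _ y).trans he)⟩
  | succ n ih =>
    obtain ⟨E, _, _, f, hE, hf, hEt⟩ := exists_injective_embedding_of_isIdealTorsion T hT
    have hS := shortExact_moduleCatMk (LinearMap.exact_map_mkQ_range f) hf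
        (Submodule.mkQ_surjective _)
    have : Injective (ModuleCat.of R E) := Module.injective_object_of_injective_module R E
    have hsub : Subsingleton (ExtLimit I (n+1+1) (ModuleCat.of R E)) :=
        subsingleton_of_injective (n+1)
    have hsub' := ih _ (hEt.of_surjective _ (Submodule.mkQ_surjective (LinearMap.range f)))
    refine subsingleton_of_forall_eq 0 fun z => ?_
    obtain ⟨w, rfl⟩ := (exact_δ_map hS (n+1) z).1 (Subsingleton.elim (h := hsub) _ _)
    exact (congrArg _ (Subsingleton.elim (h := hsub') w 0)).trans (map_zero _)

end ExtLimit

end LocalCohomologyCofinite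

/-! ### Degree shifting -/

namespace LocalCohomologyCofinite
variable {I : Ideal R}

lemma subsingleton_ext_zero {N : ModuleCat.{u} R} (h : idealTorsion I N = ⊥) :
    Subsingleton (Abelian.Ext (ModuleCat.of R (R ⧸ I)) N 0) := by
  refine (Ext.addEquiv₀ (X := ModuleCat.of R (R ⧸ I)) (Y := N)).toEquiv.subsingleton_congr.2
      (subsingleton_of_forall_eq 0 fun f => ?_)
  ext : 1
  refine Submodule.linearMap_qext _ (LinearMap.ext_ring ?_)
  refine (Submodule.mem_bot R).1 (h ▸ (⟨1, fun r hr => ?_⟩ : _ ∈ idealTorsion I N))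
  rw [pow_one] at hr
  rw [LinearMap.comp_apply, ← map_smul, ← map_smul, smul_eq_mul, mul_one, Submodule.mkQ_apply,
    (Submodule.Quotient.mk_eq_zero I).2 hr, map_zero]

variable [IsNoetherianRing R]

/-- Dividing out the torsion does not change local cohomology in positive degrees. -/
lemma ExtLimit.map_mkQ_bijective (N : ModuleCat.{u} R) (n : ℕ) :
    Function.Bijective (ExtLimit.map I (n+1) (ModuleCat.ofHom (idealTorsion I N).mkQ)) := by
  have hS := shortExact_moduleCatMk (LinearMap.exact_subtype_mkQ (idealTorsion I N))
      (Submodule.injective_subtype _) (Submodule.mkQ_surjective _)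
  have h (n : ℕ) : Subsingleton (ExtLimit I (n+1) (ModuleCat.of R (idealTorsion I N))) :=
      subsingleton_of_isIdealTorsion _ _ isIdealTorsion_idealTorsion
  constructor
  · rw [injective_iff_map_eq_zero]
    intro z hz
    obtain ⟨w, rfl⟩ := (exact_map_map hS (n+1) z).1 hz
    exact (congrArg _ (Subsingleton.elim (h := h n) w 0)).trans (map_zero _)
  · intro z
    exact (exact_map_δ hS (n+1) z).1 (Subsingleton.elim (h := h (n+1)) _ _)

/-- Degree shifting for a torsion-free module `N`: it embeds into an injective module without
`I`-torsion, which has neither local cohomology nor `Ext`s from `R / I` in any degree, so the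
cokernel `N₁` has both, shifted by one. -/
lemma exists_shift_of_idealTorsion_eq_bot (N : ModuleCat.{u} R) (hN : idealTorsion I N = ⊥) :
    ∃ N₁ : ModuleCat.{u} R, (∀ n, Nonempty (ExtLimit I n N₁ ≃ₗ[R] ExtLimit I (n+1) N)) ∧
      ∀ i, Nonempty (Abelian.Ext (ModuleCat.of R (R ⧸ I)) N₁ i ≃ₗ[R] Abelian.Ext
          (ModuleCat.of R (R ⧸ I)) N (i+1)) := by
  obtain ⟨E, _, _, f, hE, hf, hE0⟩ := exists_injective_embedding_of_idealTorsion_eq_bot (I := I) N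
      hN
  have hS := shortExact_moduleCatMk (LinearMap.exact_map_mkQ_range f) hf
      (Submodule.mkQ_surjective _)
  have : Injective (ModuleCat.of R E) := Module.injective_object_of_injective_module R E
  have hD : ∀ n, Subsingleton (ExtLimit I n (ModuleCat.of R E)) := by
    intro n
    cases n with
    | zero => exact ExtLimit.subsingleton_zero hE0
    | succ n => exact ExtLimit.subsingleton_of_injective n
  have hX : ∀ n, Subsingleton (Abelian.Ext (ModuleCat.of R (R ⧸ I)) (ModuleCat.of R E) n) := by
    intro n
    cases n with
    | zero => exact subsingleton_ext_zero hE0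
    | succ n => exact Ext.subsingleton_of_injective _ _ n
  refine ⟨ModuleCat.of R (E ⧸ LinearMap.range f), fun n =>
      ⟨LinearEquiv.ofBijective (ExtLimit.δ I hS n) ⟨?_, fun z => ?_⟩⟩,
    fun i => ⟨LinearEquiv.ofBijective (hS.extClass.postcompOfLinear R (ModuleCat.of R (R ⧸ I))
        (rfl : i + 1 = i + 1)) ⟨?_, fun z => ?_⟩⟩⟩
  · rw [injective_iff_map_eq_zero]
    intro z hz
    obtain ⟨w, rfl⟩ := (ExtLimit.exact_map_δ hS n z).1 hz
    exact (congrArg _ (Subsingleton.elim (h := hD n) w 0)).trans (map_zero _)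
  · exact (ExtLimit.exact_δ_map hS n z).1 (Subsingleton.elim (h := hD _) _ _)
  · rw [injective_iff_map_eq_zero]
    intro z hz
    obtain ⟨w, rfl⟩ := (ext_exact₃ hS _ i z).1 hz
    exact (congrArg _ (Subsingleton.elim (h := hX i) w 0)).trans (map_zero _)
  · exact (ext_exact₁ hS _ i z).1 (Subsingleton.elim (h := hX _) _ _)

/-- Degree shifting for an arbitrary module `N`: apply the torsion-free case to `N / Γ_I(N)`. Of the
three conditions that `H⁰(N)`, `N` and `N₁` have finitely generated `Ext`s from `R / I`, any two
imply the third. -/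
lemma exists_shift (N : ModuleCat.{u} R) :
    ∃ N₁ : ModuleCat.{u} R, (∀ n, Nonempty (ExtLimit I n N₁ ≃ₗ[R] ExtLimit I (n+1) N)) ∧
      (HasFiniteExt I (ModuleCat.of R (ExtLimit I 0 N)) → HasFiniteExt I N → HasFiniteExt I N₁) ∧
      (HasFiniteExt I (ModuleCat.of R (ExtLimit I 0 N)) → HasFiniteExt I N₁ → HasFiniteExt I N) ∧
      (HasFiniteExt I N → HasFiniteExt I N₁ → HasFiniteExt I
          (ModuleCat.of R (ExtLimit I 0 N))) := by
  let N' : ModuleCat.{u} R := ModuleCat.of R (N ⧸ idealTorsion I N)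
  have hN' : idealTorsion I N' = ⊥ := idealTorsion_quotient_eq_bot
  obtain ⟨N₁, hD, hX⟩ := exists_shift_of_idealTorsion_eq_bot N' hN'
  have hS := shortExact_moduleCatMk (LinearMap.exact_subtype_mkQ (idealTorsion I N))
      (Submodule.injective_subtype _) (Submodule.mkQ_surjective _)
  have e := ExtLimit.equivIdealTorsion I N
  have h1 : HasFiniteExt I N₁ → HasFiniteExt I N' := by
    intro h i
    cases i with
    | zero =>
      have := subsingleton_ext_zero hN'
      infer_instance
    | succ i =>
      have := h i
      exact Module.Finite.equiv (hX i).some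
  have h2 : HasFiniteExt I N' → HasFiniteExt I N₁ := by
    intro h i
    have := h (i+1)
    exact Module.Finite.equiv (hX i).some.symm
  refine ⟨N₁, fun n => ⟨(hD n).some ≪≫ₗ (LinearEquiv.ofBijective _
      (ExtLimit.map_mkQ_bijective N n)).symm⟩,
    fun hΓ hN => h2 (HasFiniteExt.X₃ hS (hΓ.of_linearEquiv e) hN), fun hΓ hN =>
        HasFiniteExt.X₂ hS (hΓ.of_linearEquiv e) (h1 hN),
    fun hN hN1 => HasFiniteExt.of_linearEquiv (HasFiniteExt.X₁ hS hN (h1 hN1)) e.symm⟩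

lemma hasFiniteExt_of_forall_subsingleton (N : ModuleCat.{u} R)
    (h : ∀ n, Subsingleton (ExtLimit I n N)) : HasFiniteExt I N := by
  intro i
  suffices Subsingleton (Abelian.Ext (ModuleCat.of R (R ⧸ I)) N i) by infer_instance
  induction i generalizing N with
  | zero =>
    refine subsingleton_ext_zero ?_
    rw [← ExtLimit.range_eval, eq_bot_iff]
    rintro _ ⟨z, rfl⟩
    rw [Subsingleton.elim (h := h 0) z 0, map_zero]
    exact zero_mem _
  | succ i ih =>
    have hN : idealTorsion I N = ⊥ := by
      rw [← ExtLimit.range_eval, eq_bot_iff]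
      rintro _ ⟨z, rfl⟩
      rw [Subsingleton.elim (h := h 0) z 0, map_zero]
      exact zero_mem _
    obtain ⟨N₁, hD, hX⟩ := exists_shift_of_idealTorsion_eq_bot N hN
    have := ih N₁ fun n => (hD n).some.toEquiv.subsingleton_congr.2 (h (n+1))
    exact (hX i).some.toEquiv.symm.subsingleton

/-- If all local cohomology modules of `N` have finitely generated `Ext`s from `R / I` and almost
all vanish, then `N` itself has finitely generated `Ext`s from `R / I`. -/
lemma HasFiniteExt.of_extLimit (m : ℕ) (N : ModuleCat.{u} R)
    (h : ∀ n, HasFiniteExt I (ModuleCat.of R (ExtLimit I n N)))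
    (h0 : ∀ n, m ≤ n → Subsingleton (ExtLimit I n N)) : HasFiniteExt I N := by
  induction m generalizing N with
  | zero => exact hasFiniteExt_of_forall_subsingleton N fun n => h0 n (Nat.zero_le _)
  | succ m ih =>
    obtain ⟨N₁, hD, -, hW, -⟩ := exists_shift (I := I) N
    exact hW (h 0) (ih N₁ (fun n => (h (n+1)).of_linearEquiv (hD n).some.symm)
      fun n hn => (hD n).some.toEquiv.subsingleton_congr.2 (h0 (n+1) (by omega)))

/-- If `N` and all but one of its local cohomology modules have finitely generated `Ext`s from
`R / I`, then so has the remaining one, provided almost all of them vanish. Degree shifting reduces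
to the case where the remaining one is `H⁰`. -/
theorem HasFiniteExt.extLimit (k m : ℕ) (N : ModuleCat.{u} R) (hN : HasFiniteExt I N)
    (h : ∀ n, n ≠ k → HasFiniteExt I (ModuleCat.of R (ExtLimit I n N)))
    (h0 : ∀ n, m ≤ n → Subsingleton (ExtLimit I n N)) :
        HasFiniteExt I (ModuleCat.of R (ExtLimit I k N)) := by
  induction k generalizing N with
  | zero =>
    obtain ⟨N₁, hD, -, -, hW⟩ := exists_shift (I := I) N
    exact hW hN (.of_extLimit m N₁ (fun n => (h (n+1) (by omega)).of_linearEquiv (hD n).some.symm)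
      fun n hn => (hD n).some.toEquiv.subsingleton_congr.2 (h0 (n+1) (by omega)))
  | succ k ih =>
    obtain ⟨N₁, hD, hW, -, -⟩ := exists_shift (I := I) N
    exact (ih N₁ (hW (h 0 (by omega)) hN) (fun n hn => (h (n+1) (by omega)).of_linearEquiv
        (hD n).some.symm)
      fun n hn => (hD n).some.toEquiv.subsingleton_congr.2 (h0 (n+1) (by omega))).of_linearEquiv
          (hD k).some

end LocalCohomologyCofinite

/-! ### Lengths of kernels of multiplication -/

namespace LocalCohomologyCofinite

section length
variable {M : Type*} [AddCommGroup M] [Module R M]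

lemma length_ker_eq_length_quotient_range (h : Module.length R M ≠ ⊤) (φ : M →ₗ[R] M) :
    Module.length R (LinearMap.ker φ) = Module.length R (M ⧸ LinearMap.range φ) := by
  have h1 := Module.length_eq_add_of_exact (LinearMap.ker φ).subtype φ.rangeRestrict
      (Submodule.injective_subtype _)
    φ.surjective_rangeRestrict (by
      rw [LinearMap.exact_iff, LinearMap.ker_rangeRestrict, Submodule.range_subtype])
  have h2 := Module.length_eq_add_of_exact (LinearMap.range φ).subtype (LinearMap.range φ).mkQ
      (Submodule.injective_subtype _)
    (Submodule.mkQ_surjective _) (LinearMap.exact_subtype_mkQ _)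
  rw [h2, add_comm (Module.length R (LinearMap.ker φ))] at h1
  have h3 : Module.length R (LinearMap.range φ) ≠ ⊤ :=
    ne_top_of_le_ne_top h (Module.length_le_of_injective _ (Submodule.injective_subtype _))
  exact ((ENat.add_right_injective_of_ne_top h3) h1).symm

/-- An increasing sequence of submodules of bounded length is eventually constant. -/
lemma exists_forall_le_of_length_le (D : ℕ → Submodule R M) (hD : Monotone D) {l : ℕ∞} (hl : l ≠ ⊤)
    (h : ∀ n, Module.length R (D n) ≤ l) : ∃ n, Module.length R (D n) ≠ ⊤ ∧ ∀ m, D m ≤ D n := by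
  have hfin (n : ℕ) : Module.length R (D n) ≠ ⊤ := ne_top_of_le_ne_top hl (h n)
  obtain ⟨n, hn⟩ : ∃ n, ∀ m, Module.length R (D m) ≤ Module.length R (D n) := by
    lift l to ℕ using hl
    have hb : BddAbove (Set.range fun n => (Module.length R (D n)).toNat) := by
      refine ⟨l, ?_⟩
      rintro _ ⟨n, rfl⟩
      exact ENat.toNat_le_of_le_natCast (h n)
    obtain ⟨n, hn⟩ := Nat.sSup_mem (Set.range_nonempty _) hb
    refine ⟨n, fun m => ?_⟩
    have := le_csSup hb (Set.mem_range_self m)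
    rw [← hn] at this
    rwa [← ENat.natCast_toNat (hfin m), ← ENat.natCast_toNat (hfin n), Nat.cast_le]
  refine ⟨n, hfin n, fun m => ?_⟩
  -- `D (max n m)` contains `D n` and is not longer, so the two are equal.
  refine (hD (le_max_right n m)).trans ?_
  have hle := hD (le_max_left n m)
  have h1 := Module.length_eq_add_of_exact (Submodule.inclusion hle)
      (LinearMap.range (Submodule.inclusion hle)).mkQ
    (Submodule.inclusion_injective hle) (Submodule.mkQ_surjective _)
        (LinearMap.exact_map_mkQ_range _)
  have h2 : Module.length R (D (max n m) ⧸ LinearMap.range (Submodule.inclusion hle)) = 0 := by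
    have := hn (max n m)
    rw [h1] at this
    exact ENat.add_right_injective_of_ne_top (hfin n) (le_antisymm (by simpa using this) (by simp))
  rw [Module.length_eq_zero_iff, Submodule.Quotient.subsingleton_iff, Submodule.range_inclusion]
      at h2
  intro x hx
  have : (⟨x, hx⟩ : D (max n m)) ∈ Submodule.comap (D (max n m)).subtype (D n) :=
      h2 ▸ Submodule.mem_top
  exact this

/-- The submodule `0 :_M y` of elements killed by `y`. -/
abbrev smulKer (y : R) (M : Type*) [AddCommGroup M] [Module R M] : Submodule R M :=
    LinearMap.ker (LinearMap.lsmul R M y)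

lemma length_smulKer_pow_ne_top (y : R) (h : Module.length R (smulKer y M) ≠ ⊤) (n : ℕ) :
    Module.length R (smulKer (y ^ n) M) ≠ ⊤ := by
  induction n with
  | zero =>
    have : Subsingleton (smulKer (y ^ 0) M) := by
      refine ⟨fun a b => Subtype.ext ?_⟩
      have ha := a.2
      have hb := b.2
      simp only [LinearMap.mem_ker, LinearMap.lsmul_apply, pow_zero, one_smul] at ha hb
      rw [ha, hb]
    simp
  | succ n ih =>
    let f : smulKer (y ^ (n+1)) M →ₗ[R] smulKer (y ^ n) M :=
        ((LinearMap.lsmul R M y) ∘ₗ Submodule.subtype _).codRestrict _ (by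
      intro a
      have h0 : y ^ (n + 1) • (a : M) = 0 := a.2
      exact (mul_smul (y ^ n) y (a : M)).symm.trans
        ((congrArg (· • (a : M)) (pow_succ y n).symm).trans h0))
    have h1 := Module.length_eq_add_of_exact (LinearMap.ker f).subtype f.rangeRestrict
        (Submodule.injective_subtype _)
      f.surjective_rangeRestrict (by
      rw [LinearMap.exact_iff, LinearMap.ker_rangeRestrict, Submodule.range_subtype])
    rw [h1]
    refine WithTop.add_ne_top.2 ⟨?_, ne_top_of_le_ne_top ih
        (Module.length_le_of_injective _ (Submodule.injective_subtype _))⟩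
    let g : LinearMap.ker f →ₗ[R] smulKer y M := ((Submodule.subtype _) ∘ₗ Submodule.subtype
        _).codRestrict _ (by
      intro a
      exact congrArg Subtype.val a.2)
    refine ne_top_of_le_ne_top h (Module.length_le_of_injective g fun a b hab => ?_)
    have hab' := congrArg Subtype.val hab
    exact Subtype.ext (Subtype.ext hab')

/-- Let `M` be `y`-power torsion with `0 :_M y` of finite length. Then `0 :_Q y` is finitely
generated for every quotient `Q` of `M`. Indeed `Q` is the union of the images `B n` of `0 :_M yⁿ`,
which have finite length. On a module of finite length, multiplication by `y` has kernel and
cokernel of the same length, and cokernels can only shrink under quotients, so the length of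
`0 :_{B n} y` is at most that of `0 :_M y`. Hence the submodules `0 :_{B n} y` stabilize. -/
theorem finite_smulKer_of_surjective {Q : Type*} [AddCommGroup Q] [Module R Q] (y : R)
    (htors : ∀ a : M, ∃ k, y ^ k • a = 0)
    (h : Module.length R (smulKer y M) ≠ ⊤) (π : M →ₗ[R] Q) (hπ : Function.Surjective π) :
        Module.Finite R (smulKer y Q) := by
  let B : ℕ → Submodule R Q := fun n => (smulKer (y ^ n) M).map π
  have hB : Monotone B := by
    intro m n hmn
    refine Submodule.map_mono fun a ha => ?_
    rw [LinearMap.mem_ker, LinearMap.lsmul_apply] at ha ⊢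
    obtain ⟨k, rfl⟩ := Nat.exists_eq_add_of_le hmn
    rw [add_comm, pow_add, mul_smul, ha, smul_zero]
  have hlen : ∀ n, Module.length R (B n ⊓ smulKer y Q : Submodule R Q) ≤ Module.length R
      (smulKer y M) := by
    intro n
    have hfin := length_smulKer_pow_ne_top y h n
    let p : smulKer (y ^ n) M →ₗ[R] B n := π.submoduleMap (smulKer (y ^ n) M)
    have hp : Function.Surjective p := LinearMap.submoduleMap_surjective _ _
    have hfin' : Module.length R (B n) ≠ ⊤ := ne_top_of_le_ne_top hfin
        (Module.length_le_of_surjective p hp)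
    calc Module.length R (B n ⊓ smulKer y Q : Submodule R Q)
        ≤ Module.length R (smulKer y (B n)) := by
          let f : (B n ⊓ smulKer y Q : Submodule R Q) →ₗ[R] smulKer y (B n) :=
            (Submodule.inclusion inf_le_left).codRestrict _ fun a => Subtype.ext a.2.2
          refine Module.length_le_of_injective f fun a b hab => ?_
          have hab' := congrArg (fun c : smulKer y (B n) => ((c : B n) : Q)) hab
          exact Subtype.ext hab'
      _ = Module.length R (B n ⧸ LinearMap.range (LinearMap.lsmul R (B n) y)) :=
          length_ker_eq_length_quotient_range hfin' _
      _ ≤ Module.length R (smulKer (y ^ n) M ⧸ LinearMap.range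
          (LinearMap.lsmul R (smulKer (y ^ n) M) y)) := by
          let f := Submodule.mapQ (LinearMap.range (LinearMap.lsmul R (smulKer (y ^ n) M) y))
              (LinearMap.range (LinearMap.lsmul R (B n) y)) p (by
            rintro _ ⟨a, rfl⟩
            exact ⟨p a, by simp⟩)
          refine Module.length_le_of_surjective f fun b => ?_
          obtain ⟨b, rfl⟩ := Submodule.Quotient.mk_surjective _ b
          obtain ⟨a, rfl⟩ := hp b
          exact ⟨Submodule.Quotient.mk a, rfl⟩
      _ = Module.length R (smulKer y (smulKer (y ^ n) M)) :=
          (length_ker_eq_length_quotient_range hfin _).symm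
      _ ≤ Module.length R (smulKer y M) := by
          let g : smulKer y (smulKer (y ^ n) M) →ₗ[R] smulKer y M :=
              ((Submodule.subtype _) ∘ₗ Submodule.subtype _).codRestrict _ (by
            intro a
            exact congrArg Subtype.val a.2)
          refine Module.length_le_of_injective g fun a b hab => ?_
          have hab' := congrArg Subtype.val hab
          exact Subtype.ext (Subtype.ext hab')
  obtain ⟨n, hn, hle⟩ := exists_forall_le_of_length_le (fun n => B n ⊓ smulKer y Q)
      (fun m n hmn => inf_le_inf_right _ (hB hmn)) h hlen
  have heq : smulKer y Q = B n ⊓ smulKer y Q := by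
    refine le_antisymm (fun q hq => ?_) inf_le_right
    obtain ⟨a, rfl⟩ := hπ q
    obtain ⟨k, hk⟩ := htors a
    exact hle k ⟨⟨a, hk, rfl⟩, hq⟩
  rw [heq]
  have := (isFiniteLength_iff_isNoetherian_isArtinian.1 (Module.length_ne_top_iff.1 hn)).1
  infer_instance

end length

section dimension
variable [IsNoetherianRing R] (M : Type*) [AddCommGroup M] [Module R M] [Module.Finite R M]

/-- A finitely generated module without `I`-torsion has a regular element in `I`. -/
lemma exists_isSMulRegular {I : Ideal R} (h : idealTorsion I M = ⊥) : ∃ x ∈ I,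
    IsSMulRegular M x := by
  have : Subsingleton ((R ⧸ I) →ₗ[R] M) := by
    refine subsingleton_of_forall_eq 0 fun f => ?_
    refine Submodule.linearMap_qext _ (LinearMap.ext_ring ?_)
    refine (Submodule.mem_bot R).1 (h ▸ (⟨1, fun r hr => ?_⟩ : _ ∈ idealTorsion I M))
    rw [pow_one] at hr
    rw [LinearMap.comp_apply, ← map_smul, ← map_smul, smul_eq_mul, mul_one, Submodule.mkQ_apply,
      (Submodule.Quotient.mk_eq_zero I).2 hr, map_zero]
  obtain ⟨r, hr, hreg⟩ := IsSMulRegular.subsingleton_linearMap_iff.1 this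
  rw [Ideal.annihilator_quotient] at hr
  exact ⟨r, hr, hreg⟩

variable [IsLocalRing R] {M}
lemma length_ne_top_and_isIdealTorsion_of_supportDim_le_zero (h : Module.supportDim R M ≤ 0) :
    Module.length R M ≠ ⊤ ∧ IsIdealTorsion (IsLocalRing.maximalIdeal R) M := by
  cases subsingleton_or_nontrivial M with
  | inl _ => exact ⟨by simp, fun x => ⟨0, fun r _ => Subsingleton.elim _ _⟩⟩
  | inr _ =>
  have h0 : Module.supportDim R M = 0 := by
    refine le_antisymm h ?_
    obtain ⟨d, hd⟩ := WithBot.ne_bot_iff_exists.1 (Module.supportDim_ne_bot_of_nontrivial R M)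
    rw [← hd]
    exact WithBot.coe_le_coe.2 zero_le
  constructor
  · rw [Module.length_ne_top_iff, isFiniteLength_iff_isNoetherian_isArtinian]
    refine ⟨inferInstance, ?_⟩
    have : IsArtinianRing (R ⧸ Module.annihilator R M) := by
      rw [isArtinianRing_iff_krullDimLE_zero, Ring.KrullDimLE, Order.krullDimLE_iff]
      rw [Module.supportDim_eq_ringKrullDim_quotient_annihilator] at h
      exact h
    let _ := Module.quotientAnnihilator (R := R) (M := M)
    have : Module.Finite (R ⧸ Module.annihilator R M) M :=
        Module.Finite.of_restrictScalars_finite R _ M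
    have : IsArtinian (R ⧸ Module.annihilator R M) M := inferInstance
    exact isArtinian_of_surjective_algebraMap (Ideal.Quotient.mk_surjective
        (I := Module.annihilator R M))
  · have h1 := support_of_supportDim_eq_zero R M h0
    rw [Module.support_eq_zeroLocus, PrimeSpectrum.zeroLocus_eq_iff] at h1
    obtain ⟨k, hk⟩ := Ideal.exists_pow_le_of_le_radical_of_fg (I := IsLocalRing.maximalIdeal R)
        (J := Module.annihilator R M)
      (h1 ▸ Ideal.le_radical) (IsNoetherian.noetherian _)
    exact fun x => ⟨k, fun r hr => Module.mem_annihilator.1 (hk hr) x⟩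

end dimension

variable {I : Ideal R}
/-- If multiplication by `x ∈ I` is surjective on `N`, with kernel `K`, then `Ext^i(R / I, N)`
embeds into `Ext^(i+1)(R / I, K)`, because `x` acts by zero on `Ext^i(R / I, N)`. -/
theorem HasFiniteExt.of_smulKer [IsNoetherianRing R] {N : Type u} [AddCommGroup N] [Module R N]
    {x : R} (hx : x ∈ I)
    (hN : Function.Surjective (LinearMap.lsmul R N x)) (h :
        HasFiniteExt I (ModuleCat.of R (smulKer x N))) :
    HasFiniteExt I (ModuleCat.of R N) := by
  intro i
  have hS := shortExact_moduleCatMk (LinearMap.exact_subtype_ker_map (LinearMap.lsmul R N x))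
      (Submodule.injective_subtype _) hN
  have : Module.Finite R (Abelian.Ext (ModuleCat.of R (R ⧸ I))
      (ShortComplex.moduleCatMk (LinearMap.ker (LinearMap.lsmul R N x)).subtype
    (LinearMap.lsmul R N x) (LinearMap.exact_subtype_ker_map _).linearMap_comp_eq_zero).X₁
        (i+1)) := h (i+1)
  have hx0 : x • 𝟙 (ModuleCat.of R (R ⧸ I)) = 0 := by
    ext : 1
    refine Submodule.linearMap_qext _ (LinearMap.ext_ring ?_)
    exact (Submodule.Quotient.mk_eq_zero _).2 (by simpa using hx)
  have hzero : ∀ z : Abelian.Ext (ModuleCat.of R (R ⧸ I)) (ModuleCat.of R N) i, x • z = 0 := by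
    intro z
    rw [← Ext.mk₀_id_comp (x • z), Ext.comp_smul, ← Ext.smul_comp, ← Ext.mk₀_smul, hx0]
    simp
  refine Module.Finite.of_injective (hS.extClass.postcompOfLinear R (ModuleCat.of R (R ⧸ I))
      (rfl : i + 1 = i + 1)) ?_
  refine (injective_iff_map_eq_zero _).2 fun z hz => ?_
  obtain ⟨w, rfl⟩ := (ext_exact₃ hS _ i z).1 hz
  exact (Ext.smul_eq_comp_mk₀ w x).symm.trans (hzero w)

end LocalCohomologyCofinite

/-! ### Local rings of dimension at most two -/

namespace LocalCohomologyCofinite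

section regular
variable {I : Ideal R} {A : Type u} [AddCommGroup A] [Module R A] {x : R}

lemma exact_lsmul_mkQ : Function.Exact (LinearMap.lsmul R A x) (x • (⊤ : Submodule R A)).mkQ := by
  intro a
  rw [Submodule.mkQ_apply, Submodule.Quotient.mk_eq_zero, Submodule.mem_smul_pointwise_iff_exists]
  simp

lemma ExtLimit.map_lsmul (n : ℕ) (z : ExtLimit I n (ModuleCat.of R A)) :
    ExtLimit.map I n (ModuleCat.ofHom (LinearMap.lsmul R A x)) z = x • z :=
  ExtLimit.map_smul_id x n z

namespace ExtLimit

/-- The connecting homomorphism of `0 → A → A → A / xA → 0` maps onto the kernel of `x` on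
`H^(n+1)(A)`. -/
lemma exists_surjective_smulKer (hx : IsSMulRegular A x) (n : ℕ) :
    ∃ f : ExtLimit I n (ModuleCat.of R (QuotSMulTop x A)) →ₗ[R] smulKer x
        (ExtLimit I (n+1) (ModuleCat.of R A)),
      Function.Surjective f := by
  have hS := shortExact_moduleCatMk exact_lsmul_mkQ hx (Submodule.mkQ_surjective
      (x • (⊤ : Submodule R A)))
  refine ⟨(ExtLimit.δ I hS n).codRestrict (smulKer x (ExtLimit I (n+1) (ModuleCat.of R A)))
      fun z => ?_, fun z => ?_⟩
  · exact (map_lsmul (n+1) _).symm.trans ((exact_δ_map hS n _).2 ⟨z, rfl⟩)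
  · obtain ⟨w, hw⟩ := (exact_δ_map hS n z.1).1 ((map_lsmul (n+1) _).trans z.2)
    exact ⟨w, Subtype.ext hw⟩

lemma smul_surjective (hx : IsSMulRegular A x) (n : ℕ) (h :
    Subsingleton (ExtLimit I n (ModuleCat.of R (QuotSMulTop x A)))) :
    Function.Surjective (LinearMap.lsmul R (ExtLimit I n (ModuleCat.of R A)) x) := by
  have hS := shortExact_moduleCatMk exact_lsmul_mkQ hx (Submodule.mkQ_surjective
      (x • (⊤ : Submodule R A)))
  intro z
  obtain ⟨w, hw⟩ := (exact_map_map hS n z).1 (Subsingleton.elim (h := h) _ _)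
  exact ⟨w, (map_lsmul n w).symm.trans hw⟩

/-- If `H^n(A / xA) = 0`, then `x` acts injectively on `H^(n+1)(A)`, which is `x`-power torsion and
hence zero. -/
lemma subsingleton_succ (hx : IsSMulRegular A x) (hxI : x ∈ I) (n : ℕ)
    (h : Subsingleton (ExtLimit I n (ModuleCat.of R (QuotSMulTop x A)))) :
    Subsingleton (ExtLimit I (n+1) (ModuleCat.of R A)) := by
  obtain ⟨f, hf⟩ := exists_surjective_smulKer (I := I) hx n
  have h0 (z : ExtLimit I (n+1) (ModuleCat.of R A)) (hz : x • z = 0) : z = 0 :=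
    congrArg Subtype.val (hf.subsingleton.elim (⟨z, hz⟩ : smulKer x _) 0)
  refine subsingleton_of_forall_eq 0 fun z => ?_
  obtain ⟨k, hk⟩ := isIdealTorsion (n+1) z
  replace hk := hk _ (Ideal.pow_mem_pow hxI k)
  induction k with
  | zero => simpa using hk
  | succ k ih => exact ih (h0 _ (by rwa [← mul_smul, ← pow_succ']))

end ExtLimit
lemma HasFiniteExt.extLimit_zero [IsNoetherianRing R] [Module.Finite R A] :
    HasFiniteExt I (ModuleCat.of R (ExtLimit I 0 (ModuleCat.of R A))) := by
  have := Module.Finite.equiv (ExtLimit.equivIdealTorsion I (ModuleCat.of R A)).symm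
  exact HasFiniteExt.of_finite _

end regular

section dimension
variable [IsLocalRing R]  {A : Type u} [AddCommGroup A] [Module R A] {I : Ideal R}
    [IsNoetherianRing R]

lemma supportDim_quotSMulTop_le [Module.Finite R A] {x : R} {d : ℕ}
    (hx : IsSMulRegular A x) (hxm : x ∈ IsLocalRing.maximalIdeal R)
        (h : Module.supportDim R A ≤ (d + 1 : ℕ)) :
    Module.supportDim R (QuotSMulTop x A) ≤ d := by
  rw [← Module.supportDim_quotSMulTop_succ_eq_supportDim hx hxm, Nat.cast_add, Nat.cast_one] at h
  exact ENat.WithBot.add_le_add_one_right_iff.1 h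

variable (hI : I ≤ IsLocalRing.maximalIdeal R)

variable (I A) in
/-- Dividing out the torsion does not change local cohomology in positive degrees. -/
def ExtLimit.quotientIdealTorsionEquiv (n : ℕ) :
    ExtLimit I (n+1) (ModuleCat.of R A) ≃ₗ[R] ExtLimit I (n+1)
        (ModuleCat.of R (A ⧸ idealTorsion I A)) :=
  LinearEquiv.ofBijective _ (map_mkQ_bijective (ModuleCat.of R A) n)

include hI in
/-- For `dim A ≤ 1`, local cohomology vanishes above degree `1`, and some `y ∈ I` acts on `H¹(A)`
surjectively with kernel of finite length. Here `y` is regular on `A / Γ_I(A)`, and the cokernel of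
`y` there has finite length, so that its local cohomology is concentrated in degree `0`. -/
lemma ExtLimit.of_supportDim_le_one [Module.Finite R A] (h : Module.supportDim R A ≤ 1) :
    (∀ n, Subsingleton (ExtLimit I (n+2) (ModuleCat.of R A))) ∧
      ∃ y ∈ I, Function.Surjective (LinearMap.lsmul R (ExtLimit I 1 (ModuleCat.of R A)) y) ∧
        Module.length R (smulKer y (ExtLimit I 1 (ModuleCat.of R A))) ≠ ⊤ := by
  obtain ⟨y, hyI, hy⟩ := exists_isSMulRegular (A ⧸ idealTorsion I A)
      (idealTorsion_quotient_eq_bot (I := I) (A := A))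
  have h' : Module.supportDim R (A ⧸ idealTorsion I A) ≤ (0 + 1 : ℕ) := by
    rw [zero_add, Nat.cast_one]
    exact (Module.supportDim_le_of_surjective (idealTorsion I A).mkQ
        (Submodule.mkQ_surjective _)).trans h
  obtain ⟨hlen, htors⟩ := length_ne_top_and_isIdealTorsion_of_supportDim_le_zero
      (supportDim_quotSMulTop_le hy (hI hyI) h')
  have hD n : Subsingleton (ExtLimit I (n+1) (ModuleCat.of R
      (QuotSMulTop y (A ⧸ idealTorsion I A)))) :=
    ExtLimit.subsingleton_of_isIdealTorsion _ _ fun z => (htors z).imp fun k hk r hr =>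
        hk r (Ideal.pow_right_mono hI k hr)
  have e := quotientIdealTorsionEquiv A I
  refine ⟨fun n => (e _).toEquiv.subsingleton_congr.2 (ExtLimit.subsingleton_succ hy hyI _ (hD n)),
      y, hyI, fun z => ?_, ?_⟩
  · obtain ⟨w, hw⟩ := smul_surjective hy 1 (hD 0) (e 0 z)
    exact ⟨(e 0).symm w, (e 0).injective (by simpa using hw)⟩
  · obtain ⟨f, hf⟩ := exists_surjective_smulKer (I := I) hy 0
    have h1 : Module.length R (ExtLimit I 0 (ModuleCat.of R
        (QuotSMulTop y (A ⧸ idealTorsion I A)))) ≠ ⊤ :=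
      ne_top_of_le_ne_top hlen (Module.length_le_of_injective (eval I _) eval_injective)
    refine ne_top_of_le_ne_top h1 (le_trans (Module.length_le_of_injective ?_ ?_)
        (Module.length_le_of_surjective f hf))
    · exact ((e 0).toLinearMap ∘ₗ Submodule.subtype _).codRestrict _ fun z =>
          ((e 0).map_smul y z.1).symm.trans
        ((congrArg (e 0) z.2).trans (map_zero _))
    · intro a b hab
      exact Subtype.ext ((e 0).injective (congrArg Subtype.val hab))

include hI in
/-- For `dim A ≤ 2`, local cohomology vanishes above degree `2`, and `H²(A)` has finitely generated
`Ext`s from `R / I`. With `x ∈ I` regular on `B = A / Γ_I(A)`, the module `H²(A) = H²(B)` is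
`x`-divisible and `0 :_{H²(B)} x` is a quotient of `H¹(B / xB)`, to which
`finite_smulKer_of_surjective` applies because `dim B / xB ≤ 1`. -/
lemma ExtLimit.of_supportDim_le_two [Module.Finite R A] (h : Module.supportDim R A ≤ 2) :
    (∀ n, Subsingleton (ExtLimit I (n+3) (ModuleCat.of R A))) ∧ HasFiniteExt I
        (ModuleCat.of R (ExtLimit I 2 (ModuleCat.of R A))) := by
  obtain ⟨x, hxI, hx⟩ := exists_isSMulRegular (A ⧸ idealTorsion I A)
      (idealTorsion_quotient_eq_bot (I := I) (A := A))
  have h' : Module.supportDim R (A ⧸ idealTorsion I A) ≤ (1 + 1 : ℕ) :=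
    (Module.supportDim_le_of_surjective (idealTorsion I A).mkQ (Submodule.mkQ_surjective _)).trans h
  obtain ⟨hD, y, hyI, hsurj, hlen⟩ := of_supportDim_le_one hI
      (supportDim_quotSMulTop_le hx (hI hxI) h')
  have e := quotientIdealTorsionEquiv A I
  refine ⟨fun n => (e _).toEquiv.subsingleton_congr.2 (ExtLimit.subsingleton_succ hx hxI _ (hD n)),
      ?_⟩
  refine HasFiniteExt.of_linearEquiv ?_ (e 1).symm
  refine HasFiniteExt.of_smulKer hxI (smul_surjective hx 2 (hD 0)) ?_
  obtain ⟨f, hf⟩ := exists_surjective_smulKer (I := I) hx 1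
  refine HasFiniteExt.of_smulKer hyI (fun q => ?_) ?_
  · obtain ⟨a, rfl⟩ := hf q
    obtain ⟨b, rfl⟩ := hsurj a
    exact ⟨f b, (map_smul f y b).symm⟩
  · have := finite_smulKer_of_surjective y (fun a =>
      (isIdealTorsion 1 a).imp fun k hk => hk _ (Ideal.pow_mem_pow hyI k)) hlen f hf
    exact HasFiniteExt.of_finite _

/-- Degrees `0` and `2` are known, those above `2` vanish, and `HasFiniteExt.extLimit` gives degree
`1`. -/
theorem HasFiniteExt.extLimit_of_ringKrullDim_le_two [Module.Finite R A] (h : ringKrullDim R ≤ 2)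
    (n : ℕ) :
    HasFiniteExt I (ModuleCat.of R (ExtLimit I n (ModuleCat.of R A))) := by
  -- For the unit ideal every `I`-torsion module is zero.
  by_cases hI : I = ⊤
  · have : Subsingleton (ExtLimit I n (ModuleCat.of R A)) := by
      refine subsingleton_of_forall_eq 0 fun z => ?_
      obtain ⟨k, hk⟩ := ExtLimit.isIdealTorsion n z
      exact (one_smul R z).symm.trans (hk 1 (by rw [hI, Ideal.top_pow]; trivial))
    exact HasFiniteExt.of_finite _
  obtain ⟨hD, h2⟩ := ExtLimit.of_supportDim_le_two (A := A) (IsLocalRing.le_maximalIdeal hI)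
      ((Module.supportDim_le_ringKrullDim R A).trans h)
  have h3 : ∀ n, 3 ≤ n → Subsingleton (ExtLimit I n (ModuleCat.of R A)) := fun n hn => by
    obtain ⟨n, rfl⟩ := Nat.exists_eq_add_of_le' hn
    exact hD n
  have h1 : ∀ n, n ≠ 1 → HasFiniteExt I (ModuleCat.of R (ExtLimit I n (ModuleCat.of R A))) :=
      fun n hn =>
    match n with
    | 0 => HasFiniteExt.extLimit_zero
    | 1 => absurd rfl hn
    | 2 => h2
    | n + 3 => by
      have := hD n
      exact HasFiniteExt.of_finite _
  by_cases hn : n = 1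
  · subst hn
    exact HasFiniteExt.extLimit 1 3 _ (HasFiniteExt.of_finite _) h1 h3
  · exact h1 n hn

end dimension
end LocalCohomologyCofinite

/-! ### Cofiniteness of local cohomology -/

namespace LocalCohomologyCofinite

lemma IsIdealTorsion.support_subset {I : Ideal R} {N : Type*} [AddCommGroup N] [Module R N]
    (h : IsIdealTorsion I N) :
    Module.support R N ⊆ PrimeSpectrum.zeroLocus (I : Set R) := by
  intro p hp
  obtain ⟨m, hm⟩ := Module.mem_support_iff_exists_annihilator.1 hp
  obtain ⟨k, hk⟩ := h m
  exact Ideal.IsPrime.le_of_pow_le (n := k) fun r hr =>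
      hm ((Submodule.mem_annihilator_span_singleton m r).2 (hk r hr))

variable {I : Ideal R} {M : Type u} [AddCommGroup M] [Module R M]

/-- In degrees `n ≥ 0`, the module `H I M n` is the direct limit of the `Ext^n(R / I ^ t, M)`. -/
def HEquiv (I : Ideal R) (M : Type u) [AddCommGroup M] [Module R M] (n : ℕ) :
    H I M n ≃ₗ[R] ExtLimit I n (ModuleCat.of R M) :=
  localCohomologyEquiv I n (ModuleCat.of R M)

lemma isCofinite_H_natCast_iff (n : ℕ) : IsCofinite I (H I M n) ↔ HasFiniteExt I
    (ModuleCat.of R (ExtLimit I n (ModuleCat.of R M))) := by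
  have e := HEquiv I M n
  exact ⟨fun h => HasFiniteExt.of_iso h.2 e.toModuleIso, fun h =>
    ⟨((ExtLimit.isIdealTorsion n).of_injective e.toLinearMap e.injective).support_subset,
        h.of_iso e.symm.toModuleIso⟩⟩

lemma subsingleton_H_of_neg {i : ℤ} (hi : i < 0) : Subsingleton (H I M i) :=
  match i, hi with
  | Int.negSucc _, _ => inferInstanceAs (Subsingleton PUnit)

lemma subsingleton_H_natCast_iff (n : ℕ) : Subsingleton (H I M n) ↔ Subsingleton
    (ExtLimit I n (ModuleCat.of R M)) :=
  (HEquiv I M n).toEquiv.subsingleton_congr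

variable [IsNoetherianRing R]

lemma isCofinite_of_subsingleton (N : ModuleCat.{u} R) [Subsingleton N] : IsCofinite I N :=
  ⟨by simp [Module.support_eq_empty], HasFiniteExt.of_finite N⟩

/-- If all but one of the local cohomology modules of a finitely generated module are cofinite and
they vanish in large degrees, then the remaining one is cofinite. -/
theorem isCofinite_H_of_forall_ne [Module.Finite R M] {k : ℤ}
    (h : ∀ i, i ≠ k → IsCofinite I (H I M i)) {m : ℤ}
    (h0 : ∀ i, m < i → Subsingleton (H I M i)) : IsCofinite I (H I M k) := by
  obtain hk | hk := lt_or_ge k 0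
  · have := subsingleton_H_of_neg (I := I) (M := M) hk
    exact isCofinite_of_subsingleton _
  obtain ⟨k, rfl⟩ := Int.eq_ofNat_of_zero_le hk
  rw [isCofinite_H_natCast_iff]
  exact HasFiniteExt.extLimit k (m.toNat + 1) _ (HasFiniteExt.of_finite _)
    (fun n hn => (isCofinite_H_natCast_iff n).1 (h n (by exact_mod_cast hn)))
    fun n hn => (subsingleton_H_natCast_iff n).1 (h0 n (by omega))

lemma isCofinite_H_of_finite {i : ℤ} (h : Module.Finite R (H I M i)) : IsCofinite I (H I M i) := by
  obtain hi | hi := lt_or_ge i 0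
  · have := subsingleton_H_of_neg (I := I) (M := M) hi
    exact isCofinite_of_subsingleton _
  obtain ⟨n, rfl⟩ := Int.eq_ofNat_of_zero_le hi
  have := Module.Finite.equiv (HEquiv I M n)
  exact (isCofinite_H_natCast_iff n).2 (HasFiniteExt.of_finite _)

theorem isCofinite_H_of_finite_of_subsingleton [Module.Finite R M] (h : ℤ)
    (hfin : ∀ i, i < h → Module.Finite R (H I M i)) (hzero : ∀ i, h < i → Subsingleton (H I M i))
        (i : ℤ) : IsCofinite I (H I M i) := by
  have hne : ∀ j, j ≠ h → IsCofinite I (H I M j) := fun j hj => by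
    obtain hj | hj := lt_or_gt_of_ne hj
    · exact isCofinite_H_of_finite (hfin j hj)
    · have := hzero j hj
      exact isCofinite_of_subsingleton _
  by_cases hi : i = h
  · exact hi ▸ isCofinite_H_of_forall_ne hne hzero
  · exact hne i hi

end LocalCohomologyCofinite
end

open LocalCohomologyCofinite in
theorem mainTheorem7 {R : Type u} [CommRing R] [IsNoetherianRing R] (I : Ideal R)
    (M : Type u) [AddCommGroup M] [Module R M] [Module.Finite R M] :
    -- (a)
    (IsLocalRing R → ringKrullDim R ≤ 2 →
      ∀ i : ℤ, 0 ≤ i → LocalCohomologyCofinite.IsCofinite I (LocalCohomologyCofinite.H I M i)) ∧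
    -- (b)
    (∀ h : ℤ,
      (∀ i : ℤ, i < h → Module.Finite R (LocalCohomologyCofinite.H I M i)) →
      (∀ i : ℤ, h < i → Subsingleton (LocalCohomologyCofinite.H I M i)) →
      ∀ i : ℤ, LocalCohomologyCofinite.IsCofinite I (LocalCohomologyCofinite.H I M i)) ∧
    -- (b), the particular case
    ((∀ i : ℤ, 1 < i → Subsingleton (LocalCohomologyCofinite.H I M i)) →
      ∀ i : ℤ, LocalCohomologyCofinite.IsCofinite I (LocalCohomologyCofinite.H I M i)) ∧
    -- (c)
    (∀ h : ℤ,
      (∀ i : ℤ, i ≠ h → i ≠ h + 1 → Subsingleton (LocalCohomologyCofinite.H I M i)) →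
      (LocalCohomologyCofinite.IsCofinite I (LocalCohomologyCofinite.H I M h) ↔
        LocalCohomologyCofinite.IsCofinite I (LocalCohomologyCofinite.H I M (h + 1)))) := by
  refine ⟨fun hR hdim i hi => ?_, fun h hfin hzero => isCofinite_H_of_finite_of_subsingleton h hfin
      hzero,
    fun hzero => isCofinite_H_of_finite_of_subsingleton 1 (fun i hi => ?_) hzero, fun h hzero => ?_⟩
  · obtain ⟨n, rfl⟩ := Int.eq_ofNat_of_zero_le hi
    exact (isCofinite_H_natCast_iff n).2 (HasFiniteExt.extLimit_of_ringKrullDim_le_two hdim n)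
  · obtain rfl | hi := (show i ≤ 0 by omega).eq_or_lt
    · exact Module.Finite.equiv ((HEquiv I M 0).trans (ExtLimit.equivIdealTorsion I
          (ModuleCat.of R M))).symm
    · have := subsingleton_H_of_neg (I := I) (M := M) hi
      infer_instance
  · have hne : ∀ i, i ≠ h → i ≠ h + 1 → IsCofinite I (H I M i) := fun i hi hi' => by
      have := hzero i hi hi'
      exact isCofinite_of_subsingleton _
    have hgt : ∀ i, h + 1 < i → Subsingleton (H I M i) := fun i hi => hzero i (by omega) (by omega)
    constructor
    · refine fun hc => isCofinite_H_of_forall_ne (fun i hi => ?_) hgt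
      by_cases hi' : i = h
      · exact hi' ▸ hc
      · exact hne i hi' hi
    · refine fun hc => isCofinite_H_of_forall_ne (fun i hi => ?_) hgt
      by_cases hi' : i = h + 1
      · exact hi' ▸ hc
      · exact hne i hi hi'
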